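/- Let $k$ be an algebraically closed field of characteristic $0$. For $n\ge 1$ let $C_n\subset S_n$ be the subgroup generated by the $n$-cycle $a=(1\,2\,\cdots\,n)$ and let $S_{n-1}\subset S_n$ be the subgroup of permutations fixing $n$; then $S_n=C_nS_{n-1}$ with $C_n\cap S_{n-1}=1$. For $x\in S_{n-1}$ and $b\in C_n$ define $x\rhd b\in C_n$ and $x\lhd b\in S_{n-1}$ by $xb=(x\rhd b)(x\lhd b)$. Let $J_n=k^{S_{n-1}}\#kC_n$ be the bismash product Hopf algebra, with basis $p_x\#b$ ($x\in S_{n-1}$, $b\in C_n$), multiplication $(p_x\#b)(p_y\#c)=\delta_{y,x\lhd b}\,p_x\#bc$, unit $\sum_x p_x\#1$, counit $\varepsilon(p_x\#b)=\delta_{x,1}$, comultiplication $\Delta(p_x\#b)=\sum_{y}(p_{xy^{-1}}\#(y\rhd b))\otimes(p_y\#b)$ and antipode $S(p_x\#b)=p_{(x\lhd b)^{-1}}\#(x\rhd b)^{-1}$. The (second Frobenius–Schur) indicator of a finite-dimensional irreducible representation of $J_n$ with character $\chi$ is $\nu(\chi)=\chi\left(\sum\Lambda_1\Lambda_2\right)$,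 where $\Lambda$ is the two-sided integral of $J_n$ with $\varepsilon(\Lambda)=1$ and $\Delta(\Lambda)=\sum\Lambda_1\otimes\Lambda_2$. Theorem. Fix an odd positive integer $t$, and let $n=mt$ with $m\ge 2$. Then the set of isomorphism classes of $t$-dimensional irreducible representations of $J_n$ is finite and nonempty, and the ratio $$\frac{\#\{\text{isomorphism classes of } t\text{-dimensional irreducible representations of } J_n \text{ with indicator } +1\}}{\#\{\text{isomorphism classes of } t\text{-dimensional irreducible representations of } J_n\}}$$ converges to $0$ as $m\to\infty$. -/

import Mathlib

open scoped TensorProduct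

/-- A matched pair of groups: a left action `lact` (`x ▷ a`) of `G` on the set `F` and a right
action `ract` (`x ◁ a`) of `F` on the set `G`, compatible with the two multiplications. -/
structure MatchedPair (F G : Type*) [Group F] [Group G] where
  lact : G → F → F
  ract : G → F → G
  one_lact : ∀ a, lact 1 a = a
  mul_lact : ∀ x y a, lact (x * y) a = lact x (lact y a)
  ract_one : ∀ x, ract x 1 = x
  ract_mul : ∀ x a b, ract x (a * b) = ract (ract x a) b
  lact_mul : ∀ x a b, lact x (a * b) = lact x a * lact (ract x a) b
  mul_ract : ∀ x y a, ract (x * y) a = ract x (lact y a) * ract y a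

namespace MatchedPair

theorem lact_one {F G : Type*} [Group F] [Group G] (M : MatchedPair F G) (x : G) :
    M.lact x 1 = 1 := by
  have h := M.lact_mul x 1 1
  rw [M.ract_one, mul_one] at h
  exact left_eq_mul.mp h

theorem one_ract {F G : Type*} [Group F] [Group G] (M : MatchedPair F G) (a : F) :
    M.ract 1 a = 1 := by
  have h := M.mul_ract 1 1 a
  rw [M.one_lact, mul_one] at h
  exact left_eq_mul.mp h

theorem ract_eq_one_iff {F G : Type*} [Group F] [Group G] (M : MatchedPair F G) (x : G) (a : F) :
    M.ract x a = 1 ↔ x = 1 := by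
  constructor
  · intro h
    have h2 := M.ract_mul x a a⁻¹
    rw [h, M.one_ract, mul_inv_cancel, M.ract_one] at h2
    exact h2
  · rintro rfl
    exact M.one_ract a

/-- The permutation `x ↦ x ◁ a` of `G`. -/
def ractEquiv {F G : Type*} [Group F] [Group G] (M : MatchedPair F G) (a : F) : G ≃ G where
  toFun x := M.ract x a
  invFun x := M.ract x a⁻¹
  left_inv x := by dsimp only; rw [← M.ract_mul, mul_inv_cancel, M.ract_one]
  right_inv x := by dsimp only; rw [← M.ract_mul, inv_mul_cancel, M.ract_one]

theorem inv_ract_lact {F G : Type*} [Group F] [Group G] (M : MatchedPair F G) (y : G) (a : F) :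
    M.ract y⁻¹ (M.lact y a) = (M.ract y a)⁻¹ := by
  have h := M.mul_ract y⁻¹ y a
  rw [inv_mul_cancel, M.one_ract] at h
  exact eq_inv_of_mul_eq_one_left h.symm

theorem equiv_eq {L : Type*} [Group L] {F G : Subgroup L} (h : F.IsComplement' G)
    {l : L} (a : F) (x : G) (hl : l = (a : L) * x) :
    Subgroup.IsComplement.equiv h l = (a, x) := by
  rw [← Equiv.eq_symm_apply]
  exact hl

theorem equiv_spec {L : Type*} [Group L] {F G : Subgroup L} (h : F.IsComplement' G)
    (l : L) : ((Subgroup.IsComplement.equiv h l).1 : L) * (Subgroup.IsComplement.equiv h l).2 = l :=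
  Subgroup.IsComplement.equiv_fst_mul_equiv_snd h l

theorem equiv_mul_left {L : Type*} [Group L] {F G : Subgroup L} (h : F.IsComplement' G)
    (x y : G) (a : F) : Subgroup.IsComplement.equiv h (((x * y : G) : L) * a) =
      ((Subgroup.IsComplement.equiv h ((x : L) *
          (Subgroup.IsComplement.equiv h ((y : L) * a)).1)).1,
       (Subgroup.IsComplement.equiv h ((x : L) *
          (Subgroup.IsComplement.equiv h ((y : L) * a)).1)).2
        * (Subgroup.IsComplement.equiv h ((y : L) * a)).2) := by
  apply equiv_eq
  rw [Subgroup.coe_mul, Subgroup.coe_mul, ← mul_assoc, equiv_spec, mul_assoc, mul_assoc,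
    equiv_spec]

theorem equiv_mul_right {L : Type*} [Group L] {F G : Subgroup L} (h : F.IsComplement' G)
    (x : G) (a b : F) : Subgroup.IsComplement.equiv h ((x : L) * ((a * b : F) : L)) =
      ((Subgroup.IsComplement.equiv h ((x : L) * a)).1 *
        (Subgroup.IsComplement.equiv h
          (((Subgroup.IsComplement.equiv h ((x : L) * a)).2 : L) * b)).1,
       (Subgroup.IsComplement.equiv h
          (((Subgroup.IsComplement.equiv h ((x : L) * a)).2 : L) * b)).2) := by
  apply equiv_eq
  rw [Subgroup.coe_mul, Subgroup.coe_mul, mul_assoc, equiv_spec, ← mul_assoc, ← mul_assoc,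
    equiv_spec]

/-- The matched pair of a factorization `L = F G`, `F ∩ G = 1`: for `x ∈ G` and `a ∈ F` the
elements `x ▷ a ∈ F` and `x ◁ a ∈ G` are given by `x a = (x ▷ a) (x ◁ a)`. -/
noncomputable def ofFactorization {L : Type*} [Group L] {F G : Subgroup L}
    (h : F.IsComplement' G) : MatchedPair F G where
  lact x a := (Subgroup.IsComplement.equiv h ((x : L) * a)).1
  ract x a := (Subgroup.IsComplement.equiv h ((x : L) * a)).2
  one_lact a := by rw [equiv_eq h a 1 (by simp)]
  mul_lact x y a := by rw [equiv_mul_left]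
  ract_one x := by rw [equiv_eq h 1 x (by simp)]
  ract_mul x a b := by rw [equiv_mul_right]
  lact_mul x a b := by rw [equiv_mul_right]
  mul_ract x y a := by rw [equiv_mul_left]

end MatchedPair

/-- The underlying space of the bismash product `k^G # kF`; the basis element at `(x, a)` is
`p_x # a`. -/
def Bismash (k : Type*) [Field k] {F G : Type*} [Group F] [Group G] (_M : MatchedPair F G) :=
  G × F →₀ k

namespace Bismash

section

variable {k : Type*} [Field k] {F G : Type*} [Group F] [Group G] (M : MatchedPair F G)

noncomputable instance instAddCommGroup : AddCommGroup (Bismash k M) :=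
  inferInstanceAs (AddCommGroup (G × F →₀ k))

noncomputable instance instModule : Module k (Bismash k M) :=
  inferInstanceAs (Module k (G × F →₀ k))

/-- The basis `p_x # a` of `k^G # kF`. -/
noncomputable def basis : Module.Basis (G × F) k (Bismash k M) :=
  Module.Basis.ofRepr (LinearEquiv.refl k (G × F →₀ k))

/-- Multiplication: `(p_x # a) (p_y # b) = δ_{y, x ◁ a} p_x # ab`. -/
noncomputable def mulLin : Bismash k M →ₗ[k] Bismash k M →ₗ[k] Bismash k M :=
  open Classical in
  (basis M).constr k fun p => (basis M).constr k fun q =>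
    if q.1 = M.ract p.1 p.2 then basis M (p.1, p.2 * q.2) else 0

noncomputable instance instMul : Mul (Bismash k M) := ⟨fun u v => mulLin M u v⟩

/-- The unit `1 # 1 = ∑ p_x # 1`. -/
noncomputable instance instOne [Fintype G] : One (Bismash k M) := ⟨∑ x : G, basis M (x, 1)⟩

theorem mul_def (u v : Bismash k M) : u * v = mulLin M u v := rfl

theorem one_def [Fintype G] : (1 : Bismash k M) = ∑ x : G, basis M (x, 1) := rfl

open Classical in
theorem basis_mul_basis (p q : G × F) : (basis M p * basis M q : Bismash k M) =
    if q.1 = M.ract p.1 p.2 then basis M (p.1, p.2 * q.2) else 0 := by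
  simp [mul_def, mulLin]

theorem one_mul_aux [Fintype G] (u : Bismash k M) : 1 * u = u := by
  have h : mulLin M (1 : Bismash k M) = LinearMap.id := by
    refine (basis M).ext fun q => ?_
    rw [one_def, map_sum, LinearMap.sum_apply]
    simp_rw [← mul_def]
    classical
    simp [basis_mul_basis, M.ract_one]
  exact LinearMap.congr_fun h u

theorem mul_one_aux [Fintype G] (u : Bismash k M) : u * 1 = u := by
  have h : (mulLin M).flip (1 : Bismash k M) = LinearMap.id := by
    refine (basis M).ext fun q => ?_
    rw [LinearMap.flip_apply, one_def, map_sum]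
    simp_rw [← mul_def, basis_mul_basis]
    rw [Finset.sum_eq_single (M.ract q.1 q.2)] <;> simp +contextual
  exact LinearMap.congr_fun h u

theorem mul_assoc_aux (u v w : Bismash k M) : u * v * w = u * (v * w) := by
  have h1 (p q r : G × F) : basis M p * basis M q * basis M r
      = (basis M p * (basis M q * basis M r) : Bismash k M) := by
    classical
    rw [basis_mul_basis, basis_mul_basis]
    by_cases hq : q.1 = M.ract p.1 p.2
    · by_cases hr : r.1 = M.ract q.1 q.2
      · rw [if_pos hq, if_pos hr, basis_mul_basis, basis_mul_basis, if_pos hq,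
          if_pos (by rw [hr, hq, M.ract_mul]), mul_assoc]
      · rw [if_pos hq, if_neg hr, basis_mul_basis, if_neg (by rw [M.ract_mul, ← hq]; exact hr)]
        simp [mul_def]
    · rw [if_neg hq]
      split_ifs with hr
      · rw [basis_mul_basis, if_neg hq]; simp [mul_def]
      · simp [mul_def]
  have h2 (p q : G × F) (w : Bismash k M) : basis M p * basis M q * w
      = basis M p * (basis M q * w) :=
    LinearMap.congr_fun (f := mulLin M (basis M p * basis M q))
      (g := mulLin M (basis M p) ∘ₗ mulLin M (basis M q)) ((basis M).ext fun r => h1 p q r) w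
  have h3 (p : G × F) (v w : Bismash k M) : basis M p * v * w = basis M p * (v * w) :=
    LinearMap.congr_fun (f := (mulLin M).flip w ∘ₗ mulLin M (basis M p))
      (g := mulLin M (basis M p) ∘ₗ (mulLin M).flip w) ((basis M).ext fun q => h2 p q w) v
  exact LinearMap.congr_fun (f := (mulLin M).flip w ∘ₗ (mulLin M).flip v)
      (g := (mulLin M).flip (v * w)) ((basis M).ext fun p => h3 p v w) u

variable [Fintype G]

noncomputable instance instRing : Ring (Bismash k M) :=
  { instAddCommGroup M, instMul M, instOne M with
    left_distrib := fun u v w => by simp [mul_def]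
    right_distrib := fun u v w => by simp [mul_def]
    zero_mul := fun u => by simp [mul_def]
    mul_zero := fun u => by simp [mul_def]
    mul_assoc := mul_assoc_aux M
    one_mul := one_mul_aux M
    mul_one := mul_one_aux M }

noncomputable instance instAlgebra : Algebra k (Bismash k M) :=
  Algebra.ofModule (fun c u v => by simp [mul_def]) (fun c u v => by simp [mul_def])

/-- Comultiplication:
`Δ (p_x # a) = ∑ y, (p_{x y⁻¹} # (y ▷ a)) ⊗ (p_y # a)`. -/
noncomputable def comulLin : Bismash k M →ₗ[k] Bismash k M ⊗[k] Bismash k M :=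
  (basis M).constr k fun p =>
    ∑ y : G, basis M (p.1 * y⁻¹, M.lact y p.2) ⊗ₜ[k] basis M (y, p.2)

/-- Counit: `ε (p_x # a) = δ_{x, 1}`. -/
noncomputable def counitLin : Bismash k M →ₗ[k] k :=
  open Classical in (basis M).constr k fun p => if p.1 = 1 then 1 else 0

/-- Antipode: `S (p_x # a) = p_{(x ◁ a)⁻¹} # (x ▷ a)⁻¹`. -/
noncomputable def antipodeLin : Bismash k M →ₗ[k] Bismash k M :=
  (basis M).constr k fun p => basis M ((M.ract p.1 p.2)⁻¹, (M.lact p.1 p.2)⁻¹)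

theorem comulLin_basis (p : G × F) : comulLin M (basis M p : Bismash k M) =
    ∑ y : G, basis M (p.1 * y⁻¹, M.lact y p.2) ⊗ₜ[k] basis M (y, p.2) := by
  simp [comulLin]

open Classical in
theorem counitLin_basis (p : G × F) : counitLin M (basis M p : Bismash k M) =
    if p.1 = 1 then 1 else 0 := by
  simp [counitLin]

theorem antipodeLin_basis (p : G × F) : antipodeLin M (basis M p : Bismash k M) =
    basis M ((M.ract p.1 p.2)⁻¹, (M.lact p.1 p.2)⁻¹) := by
  simp [antipodeLin]

noncomputable instance instCoalgebra : Coalgebra k (Bismash k M) where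
  comul := comulLin M
  counit := counitLin M
  coassoc := by
    refine (basis M).ext fun p => ?_
    simp only [LinearMap.comp_apply, comulLin_basis, map_sum, LinearMap.rTensor_tmul,
      LinearMap.lTensor_tmul, TensorProduct.sum_tmul, TensorProduct.tmul_sum,
      LinearEquiv.coe_coe, TensorProduct.assoc_tmul]
    rw [Finset.sum_comm]
    conv_rhs => rw [Finset.sum_comm]
    rw [Finset.sum_comm]
    refine Finset.sum_congr rfl fun z _ => ?_
    refine Fintype.sum_equiv (Equiv.mulRight z) _ _ fun y => ?_
    simp [mul_assoc, M.mul_lact]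
  rTensor_counit_comp_comul := by
    classical
    refine (basis M).ext fun p => ?_
    simp only [LinearMap.comp_apply, comulLin_basis, map_sum, LinearMap.rTensor_tmul,
      counitLin_basis, TensorProduct.mk_apply]
    rw [Finset.sum_eq_single p.1]
    · simp
    · intro b _ hb
      rw [if_neg, TensorProduct.zero_tmul]
      rw [mul_inv_eq_one]; exact fun h => hb h.symm
    · simp
  lTensor_counit_comp_comul := by
    classical
    refine (basis M).ext fun p => ?_
    simp only [LinearMap.comp_apply, comulLin_basis, map_sum, LinearMap.lTensor_tmul,
      counitLin_basis, LinearMap.flip_apply, TensorProduct.mk_apply]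
    rw [Finset.sum_eq_single 1]
    · simp [M.one_lact]
    · intro b _ hb
      simp [hb]
    · simp

theorem comul_basis (p : G × F) : Coalgebra.comul (R := k) (basis M p : Bismash k M) =
    ∑ y : G, basis M (p.1 * y⁻¹, M.lact y p.2) ⊗ₜ[k] basis M (y, p.2) :=
  comulLin_basis M p

open Classical in
theorem counit_basis (p : G × F) : Coalgebra.counit (R := k) (basis M p : Bismash k M) =
    if p.1 = 1 then 1 else 0 :=
  counitLin_basis M p

theorem comul_mul_basis (p q : G × F) :
    Coalgebra.comul (R := k) (basis M p * basis M q : Bismash k M) =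
      Coalgebra.comul (R := k) (basis M p : Bismash k M) *
        Coalgebra.comul (R := k) (basis M q : Bismash k M) := by
  classical
  rw [comul_basis, comul_basis, basis_mul_basis, Finset.sum_mul_sum]
  simp only [Algebra.TensorProduct.tmul_mul_tmul, basis_mul_basis]
  have key (y : G) : (∑ z : G,
      (if q.1 * z⁻¹ = M.ract (p.1 * y⁻¹) (M.lact y p.2) then
          (basis M (p.1 * y⁻¹, M.lact y p.2 * M.lact z q.2) : Bismash k M) else 0) ⊗ₜ[k]
        (if z = M.ract y p.2 then (basis M (y, p.2 * q.2) : Bismash k M) else 0)) =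
      if q.1 = M.ract p.1 p.2 then
        (basis M (p.1 * y⁻¹, M.lact y (p.2 * q.2)) : Bismash k M) ⊗ₜ[k]
          (basis M (y, p.2 * q.2) : Bismash k M) else 0 := by
    rw [Finset.sum_eq_single (M.ract y p.2)]
    · have hx : (q.1 * (M.ract y p.2)⁻¹ = M.ract (p.1 * y⁻¹) (M.lact y p.2)) ↔
          q.1 = M.ract p.1 p.2 := by
        have h := M.mul_ract (p.1 * y⁻¹) y p.2
        rw [inv_mul_cancel_right] at h
        rw [mul_inv_eq_iff_eq_mul, ← h]
      rw [if_pos rfl, ← M.lact_mul]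
      by_cases hq : q.1 = M.ract p.1 p.2
      · rw [if_pos (hx.2 hq), if_pos hq]
      · rw [if_neg (fun hc => hq (hx.1 hc)), if_neg hq, TensorProduct.zero_tmul]
    · intro z _ hz
      rw [if_neg hz, TensorProduct.tmul_zero]
    · simp
  simp only [key]
  split_ifs with hq
  · rw [comul_basis]
  · simp

theorem counit_mul_basis (p q : G × F) :
    Coalgebra.counit (R := k) (basis M p * basis M q : Bismash k M) =
      Coalgebra.counit (R := k) (basis M p : Bismash k M) *
        Coalgebra.counit (R := k) (basis M q : Bismash k M) := by
  classical
  rw [counit_basis, counit_basis, basis_mul_basis]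
  by_cases hq : q.1 = M.ract p.1 p.2
  · rw [if_pos hq, counit_basis]
    by_cases hp : p.1 = 1
    · simp [hp, hq, M.one_ract]
    · simp [hp]
  · rw [if_neg hq]
    by_cases hp : p.1 = 1
    · rw [hp, M.one_ract] at hq
      simp [hq]
    · simp [hp]

noncomputable instance instBialgebra : Bialgebra k (Bismash k M) where
  counit_one := by
    classical
    rw [one_def, map_sum]
    simp [counit_basis]
  mul_compr₂_counit := by
    refine (basis M).ext fun p => (basis M).ext fun q => ?_
    exact counit_mul_basis M p q
  comul_one := by
    rw [one_def, map_sum, Algebra.TensorProduct.one_def, one_def]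
    simp only [comul_basis, TensorProduct.sum_tmul, TensorProduct.tmul_sum, M.lact_one]
    rw [Finset.sum_comm]
    refine Finset.sum_congr rfl fun y _ => ?_
    exact Fintype.sum_equiv (Equiv.mulRight y⁻¹) _ _ fun x => rfl
  mul_compr₂_comul := by
    refine (basis M).ext fun p => (basis M).ext fun q => ?_
    exact comul_mul_basis M p q

noncomputable instance instHopfAlgebra : HopfAlgebra k (Bismash k M) where
  antipode := antipodeLin M
  mul_antipode_rTensor_comul := by
    classical
    refine (basis M).ext fun p => ?_
    simp only [LinearMap.comp_apply, comul_basis, map_sum, LinearMap.rTensor_tmul,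
      antipodeLin_basis, LinearMap.mul'_apply, counit_basis, basis_mul_basis,
      Algebra.linearMap_apply]
    have hx (y : G) : (M.ract (p.1 * y⁻¹) (M.lact y p.2))⁻¹ =
        M.ract (y * p.1⁻¹) (M.lact p.1 p.2) := by
      have h := M.inv_ract_lact (p.1 * y⁻¹) (M.lact y p.2)
      rw [← M.mul_lact, inv_mul_cancel_right, mul_inv_rev, inv_inv] at h
      exact h.symm
    have hc (y : G) : (y = M.ract (M.ract (p.1 * y⁻¹) (M.lact y p.2))⁻¹
        (M.lact (p.1 * y⁻¹) (M.lact y p.2))⁻¹) ↔ p.1 = 1 := by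
      rw [hx, ← M.mul_lact, inv_mul_cancel_right, ← M.ract_mul, mul_inv_cancel, M.ract_one,
        left_eq_mul, inv_eq_one]
    simp only [hc]
    by_cases hp : p.1 = 1
    · have hr (y : G) : (M.ract (p.1 * y⁻¹) (M.lact y p.2))⁻¹ = M.ract y p.2 := by
        rw [hx, hp, M.one_lact, inv_one, mul_one]
      have hl (y : G) : (M.lact (p.1 * y⁻¹) (M.lact y p.2))⁻¹ * p.2 = 1 := by
        rw [← M.mul_lact, inv_mul_cancel_right, hp, M.one_lact, inv_mul_cancel]
      simp only [hr, hl, if_pos hp, map_one]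
      rw [one_def]
      exact Fintype.sum_equiv (M.ractEquiv p.2) _ _ fun y => rfl
    · simp [hp]
  mul_antipode_lTensor_comul := by
    classical
    refine (basis M).ext fun p => ?_
    simp only [LinearMap.comp_apply, comul_basis, map_sum, LinearMap.lTensor_tmul,
      antipodeLin_basis, LinearMap.mul'_apply, counit_basis, basis_mul_basis,
      Algebra.linearMap_apply, mul_inv_cancel]
    have hc (y : G) : ((M.ract y p.2)⁻¹ = M.ract (p.1 * y⁻¹) (M.lact y p.2)) ↔ p.1 = 1 := by
      have h := M.mul_ract (p.1 * y⁻¹) y p.2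
      rw [inv_mul_cancel_right] at h
      rw [eq_comm, ← mul_eq_one_iff_eq_inv, ← h, M.ract_eq_one_iff]
    simp only [hc]
    by_cases hp : p.1 = 1
    · simp only [hp, if_true, map_one, one_mul]
      rw [one_def]
      exact Fintype.sum_equiv (Equiv.inv G) _ _ fun y => rfl
    · simp [hp]

/-- The two-sided integral `Λ = |F|⁻¹ ∑ p_1 # a`, normalized by `ε Λ = 1`; see
`integral_unique` for its characterization. -/
noncomputable def integral [Fintype F] : Bismash k M :=
  (Fintype.card F : k)⁻¹ • ∑ a : F, basis M (1, a)

theorem counit_integral [Fintype F] [CharZero k] :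
    Coalgebra.counit (R := k) (integral M : Bismash k M) = 1 := by
  classical
  simp [integral, map_smul, map_sum, counit_basis]

theorem mul_integral [Fintype F] (u : Bismash k M) :
    u * integral M = Coalgebra.counit (R := k) u • (integral M : Bismash k M) := by
  classical
  refine LinearMap.congr_fun (f := (LinearMap.mul k (Bismash k M)).flip (integral M))
    (g := LinearMap.smulRight (Coalgebra.counit (R := k)) (integral M))
    ((basis M).ext fun p => ?_) u
  simp only [LinearMap.flip_apply, LinearMap.mul_apply', LinearMap.smulRight_apply, counit_basis]
  rw [integral, mul_smul_comm, Finset.mul_sum, smul_comm]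
  congr 1
  have hc : (1 = M.ract p.1 p.2) ↔ p.1 = 1 := by rw [eq_comm, M.ract_eq_one_iff]
  simp only [basis_mul_basis, hc]
  by_cases hp : p.1 = 1
  · simp only [hp, if_true, one_smul]
    exact Fintype.sum_equiv (Equiv.mulLeft p.2) _ _ fun y => rfl
  · simp [hp]

theorem integral_mul [Fintype F] (u : Bismash k M) :
    integral M * u = Coalgebra.counit (R := k) u • (integral M : Bismash k M) := by
  classical
  refine LinearMap.congr_fun (f := LinearMap.mul k (Bismash k M) (integral M))
    (g := LinearMap.smulRight (Coalgebra.counit (R := k)) (integral M))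
    ((basis M).ext fun p => ?_) u
  simp only [LinearMap.mul_apply', LinearMap.smulRight_apply, counit_basis]
  rw [integral, smul_mul_assoc, Finset.sum_mul, smul_comm]
  congr 1
  simp only [basis_mul_basis, M.one_ract]
  by_cases hp : p.1 = 1
  · simp only [hp, if_true, one_smul]
    exact Fintype.sum_equiv (Equiv.mulRight p.2) _ _ fun y => rfl
  · simp [hp]

theorem integral_unique [Fintype F] [CharZero k] (Λ : Bismash k M)
    (hΛ : ∀ u : Bismash k M, u * Λ = Coalgebra.counit (R := k) u • Λ)
    (h1 : Coalgebra.counit (R := k) Λ = 1) : Λ = integral M := by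
  have h := hΛ (integral M)
  rw [integral_mul, h1, counit_integral, one_smul, one_smul] at h
  exact h.symm

end

end Bismash

/-- A `t`-dimensional representation of a `k`-algebra `A` on `k^t` is irreducible if `k^t` is
nonzero and has no invariant subspaces other than `0` and `k^t`. -/
def IsIrreducibleRep {k A : Type*} [Field k] [Ring A] [Algebra k A] {t : ℕ}
    (ρ : A →ₐ[k] Module.End k (Fin t → k)) : Prop :=
  0 < t ∧ ∀ W : Submodule k (Fin t → k), (∀ a, ∀ w ∈ W, ρ a w ∈ W) → W = ⊥ ∨ W = ⊤

/-- The irreducible representations of `A` on `k^t`. -/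
def IrrepOn (k A : Type*) [Field k] [Ring A] [Algebra k A] (t : ℕ) :=
  {ρ : A →ₐ[k] Module.End k (Fin t → k) // IsIrreducibleRep ρ}

/-- Two representations are isomorphic if a linear automorphism of `k^t` intertwines them. -/
def irrepSetoid (k A : Type*) [Field k] [Ring A] [Algebra k A] (t : ℕ) :
    Setoid (IrrepOn k A t) where
  r ρ σ := ∃ e : (Fin t → k) ≃ₗ[k] (Fin t → k), ∀ a v, e (ρ.1 a v) = σ.1 a (e v)
  iseqv :=
    { refl := fun _ => ⟨LinearEquiv.refl _ _, fun _ _ => rfl⟩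
      symm := fun ⟨e, he⟩ => ⟨e.symm, fun a v => by
        rw [LinearEquiv.symm_apply_eq, he, LinearEquiv.apply_symm_apply]⟩
      trans := fun ⟨e, he⟩ ⟨f, hf⟩ => ⟨e.trans f, fun a v => by
        simp [he, hf]⟩ }

/-- The set of isomorphism classes of `t`-dimensional irreducible representations of `A`. -/
def Irrep (k A : Type*) [Field k] [Ring A] [Algebra k A] (t : ℕ) :=
  Quotient (irrepSetoid k A t)

/-- The character of an isomorphism class of irreducible representations. -/
noncomputable def Irrep.character {k A : Type*} [Field k] [Ring A] [Algebra k A] {t : ℕ}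
    (V : Irrep k A t) (a : A) : k :=
  Quotient.liftOn V (fun ρ => LinearMap.trace k (Fin t → k) (ρ.1 a)) fun ρ σ ⟨e, he⟩ => by
    have h : σ.1 a = e.conj (ρ.1 a) := by
      refine LinearMap.ext fun v => ?_
      rw [LinearEquiv.conj_apply_apply, he, LinearEquiv.apply_symm_apply]
    simp only [h, LinearMap.trace_conj']

/-- The (second) Frobenius-Schur indicator `ν(χ) = χ(∑ Λ₁ Λ₂)` of an irreducible representation
of a bismash product, `Λ` being the normalized two-sided integral and `∑ Λ₁ ⊗ Λ₂ = Δ Λ`. -/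
noncomputable def Bismash.indicator {k : Type*} [Field k] {F G : Type*} [Group F] [Group G]
    [Fintype F] [Fintype G] {M : MatchedPair F G} {t : ℕ} (V : Irrep k (Bismash k M) t) : k :=
  V.character (LinearMap.mul' k (Bismash k M)
    (Coalgebra.comul (R := k) (Bismash.integral M : Bismash k M)))

/-- The subgroup `C_n` of `S_n` generated by the standard `n`-cycle `(1 2 ⋯ n)`. The set
`{1, …, n}` is identified with `Fin n` through residues modulo `n`, so that `n` is `0`. -/
def cycleSubgroup (n : ℕ) : Subgroup (Equiv.Perm (Fin n)) := Subgroup.zpowers (finRotate n)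

/-- The subgroup `S_{n-1}` of `S_n`: the permutations that fix `n`, that is the residue `0`. -/
def fixSubgroup (n : ℕ) : Subgroup (Equiv.Perm (Fin n)) where
  carrier := {σ | ∀ i : Fin n, (i : ℕ) = 0 → σ i = i}
  one_mem' := fun _ _ => rfl
  mul_mem' := fun {σ τ} hσ hτ i hi => by rw [Equiv.Perm.mul_apply, hτ i hi, hσ i hi]
  inv_mem' := fun {σ} hσ i hi => by rw [Equiv.Perm.inv_eq_iff_eq, hσ i hi]

noncomputable instance (n : ℕ) : Fintype (cycleSubgroup n) := Fintype.ofFinite _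

noncomputable instance (n : ℕ) : Fintype (fixSubgroup n) := Fintype.ofFinite _

theorem finRotate_pow_apply (n : ℕ) (r : ℕ) (i : Fin (n + 1)) :
    ((finRotate (n + 1)) ^ r) i = i + Fin.ofNat (n + 1) r := by
  induction r with
  | zero => ext; simp
  | succ r ih =>
    rw [pow_succ', Equiv.Perm.mul_apply, ih, finRotate_apply]
    ext
    simp [Fin.val_add, add_assoc]

/-- `S_n = C_n S_{n-1}` with `C_n ∩ S_{n-1} = 1`. -/
theorem isComplement_cycle_fix (n : ℕ) : (cycleSubgroup n).IsComplement' (fixSubgroup n) := by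
  cases n with
  | zero =>
    refine Subgroup.isComplement'_of_disjoint_and_mul_eq_univ ?_ ?_
    · rw [Subgroup.disjoint_def]
      intro x _ _
      exact Subsingleton.elim _ _
    · ext x
      simp only [Set.mem_univ, iff_true]
      exact ⟨1, one_mem _, 1, one_mem _, Subsingleton.elim _ _⟩
  | succ n =>
    refine Subgroup.isComplement'_of_disjoint_and_mul_eq_univ ?_ ?_
    · rw [Subgroup.disjoint_def]
      intro x hx hx'
      obtain ⟨r, rfl⟩ := (mem_powers_iff_mem_zpowers.2 hx)
      have h0 : ((finRotate (n + 1)) ^ r) 0 = 0 := hx' 0 rfl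
      rw [finRotate_pow_apply, zero_add] at h0
      ext1 i
      change ((finRotate (n + 1)) ^ r) i = i
      rw [finRotate_pow_apply, h0, add_zero]
    · ext x
      simp only [Set.mem_univ, iff_true]
      refine ⟨finRotate (n + 1) ^ ((x 0 : Fin (n + 1)) : ℕ),
        Subgroup.pow_mem _ (Subgroup.mem_zpowers _) _,
        (finRotate (n + 1) ^ ((x 0 : Fin (n + 1)) : ℕ))⁻¹ * x, ?_, by simp⟩
      intro i hi
      obtain rfl : i = 0 := Fin.ext hi
      rw [Equiv.Perm.mul_apply, Equiv.Perm.inv_eq_iff_eq, finRotate_pow_apply, zero_add]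
      ext
      simp

/-- The bismash product `J_n = k^{S_{n-1}} # k C_n` of the factorization `S_n = C_n S_{n-1}`. -/
abbrev J (k : Type*) [Field k] (n : ℕ) :=
  Bismash k (MatchedPair.ofFactorization (isComplement_cycle_fix n))

/-! Write F for the cycle group and G for the point stabilizer. As F is cyclic, an irreducible
representation of `J k n` contains an eigenvector w of F; its components `p_y w`, for y in one
F-orbit on G, form a basis permuted by F up to scalars. So the irreducibles of dimension t come from
the points z of G with orbit of size t and the characters ψ of F. The map (z, ψ) ↦ representation is
onto, and all its fibres have the same size, because a subgroup of a cyclic group is determined by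
its order (`card_orbitIrrep_fiber_eq`). A nonzero indicator forces the orbit of z to contain some y
together with y⁻¹. Hence the proportion of indicator 1 is at most the proportion of such z
(`card_indicator_eq_one_mul_le`).

Identify G with the permutations of ℤ/n fixing 0; then F acts by z ↦ z(· + r) - z(r) and stabilizers
are groups of periods. An orbit of size t means that the periods are exactly the multiples of t;
then z(i + t) = z(i) + tu for a unit u modulo m. This u is constant on the orbit and is inverted
with the permutation, so an orbit containing y and y⁻¹ has u² = 1 (`SelfDual.exists_unit`). The
permutations with z(i + t) = z(i) + tu are equally numerous for all units u, and for m ≥ t at least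
one in t of them has no further period (`card_twist_le_mul`, where t odd enters). The ratio is
therefore at most t · #{u² = 1} / φ(m), that is, t divided by the number of squares of units modulo
m, and that number tends to infinity (`tendsto_squareUnitsCard`). -/

/-! ### Squares of units modulo m -/

/-- The number of squares in the group of units modulo `m`. -/
noncomputable def squareUnitsCard (m : ℕ) : ℕ :=
  Nat.card (powMonoidHom 2 : (ZMod m)ˣ →* (ZMod m)ˣ).range

/-- If every prime power exactly dividing m were at most N, each would divide N!, hence so would m.
-/
theorem exists_factorization_pow_gt (N m : ℕ) (hm : N.factorial < m) :
    ∃ p : ℕ, p.Prime ∧ N < p ^ m.factorization p := by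
  by_contra! h
  have hm0 : m ≠ 0 := by omega
  have hd : m ∣ N.factorial := by
    rw [← Nat.factorization_le_iff_dvd hm0 N.factorial_ne_zero]
    intro p
    by_cases hp : p.Prime
    · exact (hp.pow_dvd_iff_le_factorization N.factorial_ne_zero).1
        (Nat.dvd_factorial (pow_pos hp.pos _) (h p hp))
    · simp [Nat.factorization_eq_zero_of_not_prime m hp]
  exact absurd (Nat.le_of_dvd N.factorial_pos hd) (by omega)

/-- The powers x^(2i) with i < K are distinct integers below q, so they stay distinct modulo q; x
lifts to a unit modulo m, whose even powers are squares. -/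
theorem le_squareUnitsCard {m q x K : ℕ} (hm : m ≠ 0) (hq : q ∣ m) (hx : 1 < x)
    (hxq : x.Coprime q) (hK : x ^ (2 * K) ≤ q) : K ≤ squareUnitsCard m := by
  have : NeZero m := ⟨hm⟩
  obtain ⟨u, hu⟩ := ZMod.unitsMap_surjective hq (ZMod.unitOfCoprime x hxq)
  let f : Fin K → (powMonoidHom 2 : (ZMod m)ˣ →* (ZMod m)ˣ).range :=
    fun i => ⟨(u ^ (i : ℕ)) ^ 2, ⟨u ^ (i : ℕ), rfl⟩⟩
  have hf : Function.Injective f := by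
    intro i j hij
    have h1 : (u ^ (i : ℕ)) ^ 2 = (u ^ (j : ℕ)) ^ 2 := congrArg Subtype.val hij
    have h2 := congrArg (fun w => ((ZMod.unitsMap hq w : (ZMod q)ˣ) : ZMod q)) h1
    simp only [map_pow, hu, Units.val_pow_eq_pow_val, ZMod.coe_unitOfCoprime] at h2
    rw [← pow_mul, ← pow_mul] at h2
    have h3 : ((x ^ ((i : ℕ) * 2) : ℕ) : ZMod q) = ((x ^ ((j : ℕ) * 2) : ℕ) : ZMod q) := by
      push_cast; exact h2
    rw [ZMod.natCast_eq_natCast_iff'] at h3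
    have hlt (l : Fin K) : x ^ ((l : ℕ) * 2) < q :=
      (Nat.pow_lt_pow_right hx (by omega)).trans_le hK
    rw [Nat.mod_eq_of_lt (hlt i), Nat.mod_eq_of_lt (hlt j)] at h3
    have := Nat.pow_right_injective hx h3
    exact Fin.ext (by omega)
  simpa [squareUnitsCard] using Nat.card_le_card_of_injective f hf

theorem tendsto_squareUnitsCard : Filter.Tendsto squareUnitsCard Filter.atTop Filter.atTop := by
  refine Filter.tendsto_atTop.2 fun K => ?_
  -- The bound 3^(2K) serves both bases: x = 3 if the large prime power is a power of 2, and x = 2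
  -- otherwise.
  filter_upwards [Filter.eventually_gt_atTop (3 ^ (2 * K)).factorial] with m hm
  obtain ⟨p, hp, hlt⟩ := exists_factorization_pow_gt _ m hm
  have hm0 : m ≠ 0 := by omega
  have hd := Nat.ordProj_dvd m p
  by_cases h2 : p = 2
  · subst h2
    exact le_squareUnitsCard (x := 3) hm0 hd (by norm_num)
      (Nat.Coprime.pow_right _ (by norm_num)) hlt.le
  · refine le_squareUnitsCard (x := 2) hm0 hd (by norm_num)
      (Nat.Coprime.pow_right _ ?_) (le_trans (Nat.pow_le_pow_left (by norm_num) _) hlt.le)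
    exact (Nat.coprime_primes Nat.prime_two hp).2 (Ne.symm h2)

/-- Kernel times image for the squaring homomorphism. -/
theorem card_sq_eq_one_mul_squareUnitsCard (m : ℕ) [NeZero m] :
    Nat.card {u : (ZMod m)ˣ // u ^ 2 = 1} * squareUnitsCard m = m.totient := by
  have h := (powMonoidHom 2 : (ZMod m)ˣ →* (ZMod m)ˣ).ker.card_mul_index
  rw [Subgroup.index_ker, Nat.card_eq_fintype_card (α := (ZMod m)ˣ),
    ZMod.card_units_eq_totient] at h
  rw [← h]
  rfl

theorem squareUnitsCard_pos (m : ℕ) [NeZero m] : 0 < squareUnitsCard m :=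
  Nat.card_pos

/-! ### Subgroups of cyclic groups, and characters -/

/-- In a cyclic group x^d = 1 has at most d solutions, and a subgroup of order d already supplies d
of them. So its order determines it. -/
theorem mem_subgroup_iff_pow_card_eq_one {F : Type*} [Group F] [Finite F] [IsCyclic F]
    (H : Subgroup F) (x : F) : x ∈ H ↔ x ^ Nat.card H = 1 := by
  classical
  have := Fintype.ofFinite F
  have hsub : (Finset.univ.filter fun y : F => y ∈ H) ⊆
      Finset.univ.filter fun y : F => y ^ Nat.card H = 1 := by
    intro y hy
    simp only [Finset.mem_filter, Finset.mem_univ, true_and] at hy ⊢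
    exact orderOf_dvd_iff_pow_eq_one.1 (H.orderOf_dvd_natCard hy)
  have hcard : (Finset.univ.filter fun y : F => y ∈ H).card = Nat.card H := by
    rw [← Fintype.card_subtype, ← Nat.card_eq_fintype_card]
  have heq := Finset.eq_of_subset_of_card_le hsub
    ((IsCyclic.card_pow_eq_one_le Nat.card_pos).trans hcard.ge)
  have := Finset.ext_iff.1 heq x
  simpa using this

instance finite_monoidHom_units {F k : Type*} [Group F] [Finite F] [Field k] :
    Finite (F →* kˣ) := by
  have : NeZero (Nat.card F) := ⟨Nat.card_pos.ne'⟩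
  refine Finite.of_injective
    (fun (ψ : F →* kˣ) (a : F) => (⟨ψ a, by
      rw [mem_rootsOfUnity, ← map_pow, pow_card_eq_one', map_one]⟩ :
        rootsOfUnity (Nat.card F) k)) ?_
  intro ψ φ h
  ext a
  have := congrArg (fun u => ((u.1 : kˣ) : k)) (congrFun h a)
  exact this

/-! ### Orbits and stabilizers of the right action -/

namespace MatchedPair

variable {F G : Type*} [Group F] [Group G] (M : MatchedPair F G)

/-- The orbit of `z` under the right action of `F` on `G`. -/
def orb (z : G) : Set G := Set.range fun b => M.ract z b

theorem mem_orb_self (z : G) : z ∈ M.orb z := ⟨1, M.ract_one z⟩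

theorem ract_mem_orb {z y : G} (b : F) (hy : y ∈ M.orb z) : M.ract y b ∈ M.orb z := by
  obtain ⟨c, rfl⟩ := hy
  exact ⟨c * b, M.ract_mul z c b⟩

theorem ract_mem_orb_iff {z y : G} (b : F) : M.ract y b ∈ M.orb z ↔ y ∈ M.orb z := by
  refine ⟨fun h => ?_, M.ract_mem_orb b⟩
  have := M.ract_mem_orb b⁻¹ h
  rwa [← M.ract_mul, mul_inv_cancel, M.ract_one] at this

theorem mem_orb_symm {z y : G} (hy : y ∈ M.orb z) : z ∈ M.orb y := by
  obtain ⟨c, rfl⟩ := hy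
  exact ⟨c⁻¹, by dsimp only; rw [← M.ract_mul, mul_inv_cancel, M.ract_one]⟩

theorem orb_eq_of_mem {z y : G} (hy : y ∈ M.orb z) : M.orb y = M.orb z := by
  ext x
  constructor
  · rintro ⟨b, rfl⟩
    exact M.ract_mem_orb b hy
  · rintro ⟨b, rfl⟩
    exact M.ract_mem_orb b (M.mem_orb_symm hy)

theorem exists_ract_eq {z x y : G} (hx : x ∈ M.orb z) (hy : y ∈ M.orb z) :
    ∃ b, M.ract x b = y := by
  rw [← M.orb_eq_of_mem hx] at hy
  exact hy

/-- The stabilizer of `z` under the right action of `F` on `G`. -/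
def stab (z : G) : Subgroup F where
  carrier := {b | M.ract z b = z}
  one_mem' := M.ract_one z
  mul_mem' {a b} ha hb := by
    rw [Set.mem_ofPred_eq] at ha hb ⊢
    rw [M.ract_mul, ha, hb]
  inv_mem' {a} ha := by
    rw [Set.mem_ofPred_eq] at ha ⊢
    conv_lhs => rw [← ha]
    rw [← M.ract_mul, mul_inv_cancel, M.ract_one]

theorem mem_stab {z : G} {b : F} : b ∈ M.stab z ↔ M.ract z b = z := Iff.rfl

theorem ract_eq_ract_iff {z : G} {a b : F} :
    M.ract z a = M.ract z b ↔ a * b⁻¹ ∈ M.stab z := by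
  rw [mem_stab, M.ract_mul]
  constructor
  · intro h
    rw [h, ← M.ract_mul, mul_inv_cancel, M.ract_one]
  · intro h
    conv_rhs => rw [← h]
    rw [← M.ract_mul, inv_mul_cancel, M.ract_one]

/-- The orbit of `z` is in bijection with the left cosets of its stabilizer. -/
noncomputable def quotientStabEquivOrb (z : G) : F ⧸ M.stab z ≃ M.orb z :=
  Equiv.ofBijective
    -- The inverse reconciles left cosets with a right action: z ◁ b⁻¹ depends only on b · Stab(z).
    (Quotient.lift (fun b : F => (⟨M.ract z b⁻¹, b⁻¹, rfl⟩ : M.orb z)) (by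
      intro a b hab
      refine Subtype.ext ?_
      dsimp only
      rw [ract_eq_ract_iff, inv_inv]
      exact QuotientGroup.leftRel_apply.1 hab))
    (by
      constructor
      · intro x y
        induction x using Quotient.inductionOn
        induction y using Quotient.inductionOn
        intro h
        have h' := congrArg Subtype.val h
        simp only [Quotient.lift_mk] at h'
        rw [ract_eq_ract_iff, inv_inv] at h'
        exact Quotient.sound (QuotientGroup.leftRel_apply.2 h')
      · rintro ⟨_, b, rfl⟩
        refine ⟨Quotient.mk _ b⁻¹, ?_⟩
        simp)

theorem card_orb_mul_card_stab (z : G) :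
    Nat.card (M.orb z) * Nat.card (M.stab z) = Nat.card F := by
  rw [← Nat.card_congr (M.quotientStabEquivOrb z)]
  exact (M.stab z).card_eq_card_quotient_mul_card_subgroup.symm

theorem stab_eq_of_card_orb_eq [Finite F] [IsCyclic F] {z y : G}
    (h : Nat.card (M.orb z) = Nat.card (M.orb y)) : M.stab z = M.stab y := by
  have hz := M.card_orb_mul_card_stab z
  have hy := M.card_orb_mul_card_stab y
  have hpos : 0 < Nat.card (M.orb y) := by
    refine Nat.pos_of_ne_zero fun h0 => ?_
    rw [h0, zero_mul] at hy
    exact Nat.card_pos.ne hy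
  have hc : Nat.card (M.stab z) = Nat.card (M.stab y) := by
    rw [h, ← hy] at hz
    exact Nat.eq_of_mul_eq_mul_left hpos hz
  ext b
  rw [mem_subgroup_iff_pow_card_eq_one, mem_subgroup_iff_pow_card_eq_one, hc]

/-- An enumeration by `Fin t` of an orbit of `F` on `G`. -/
structure OrbitEnum (t : ℕ) where
  /-- The base point of the orbit. -/
  base : G
  /-- The enumeration. -/
  equiv : Fin t ≃ M.orb base

/-- The `i`-th point of an enumerated orbit. -/
def OrbitEnum.pt {M : MatchedPair F G} {t : ℕ} (o : M.OrbitEnum t) (i : Fin t) : G :=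
  (o.equiv i : G)

theorem OrbitEnum.pt_injective {M : MatchedPair F G} {t : ℕ} (o : M.OrbitEnum t) :
    Function.Injective o.pt := fun _ _ h => o.equiv.injective (Subtype.ext h)

theorem OrbitEnum.exists_pt_eq {M : MatchedPair F G} {t : ℕ} (o : M.OrbitEnum t) {y : G} :
    (∃ i, o.pt i = y) ↔ y ∈ M.orb o.base := by
  constructor
  · rintro ⟨i, rfl⟩
    exact (o.equiv i).2
  · intro h
    exact ⟨o.equiv.symm ⟨y, h⟩, by simp [OrbitEnum.pt]⟩

theorem OrbitEnum.exists_ract {M : MatchedPair F G} {t : ℕ} (o : M.OrbitEnum t) (i : Fin t)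
    (b : F) : ∃ j, o.pt j = M.ract (o.pt i) b :=
  o.exists_pt_eq.2 (M.ract_mem_orb b (o.equiv i).2)

/-- An enumeration of the orbit of `z`. -/
noncomputable def orbitEnum [Finite F] {t : ℕ} (z : {z : G // Nat.card (M.orb z) = t}) :
    M.OrbitEnum t where
  base := z.1
  equiv := by
    have : Finite (M.orb z.1) := Set.finite_range _
    exact (Finite.equivFinOfCardEq z.2).symm

end MatchedPair

/-! ### Representations on the functions on an orbit -/

namespace Bismash

variable {k : Type*} [Field k] {F G : Type*} [Group F] [Group G] [Fintype G]
  {M : MatchedPair F G} {t : ℕ}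

/-- The matrix by which an element acts on the functions on an orbit, with `p_x # b` acting by
`f ↦ (y ↦ δ_{x,y} ψ(b) f(x ◁ b))`. -/
noncomputable def orbitMatrix (o : M.OrbitEnum t) (ψ : F →* kˣ) :
    Bismash k M →ₗ[k] Matrix (Fin t) (Fin t) k :=
  open Classical in
  (basis M).constr k fun p => Matrix.of fun i j =>
    if o.pt i = p.1 ∧ o.pt j = M.ract p.1 p.2 then (ψ p.2 : k) else 0

open Classical in
theorem orbitMatrix_basis (o : M.OrbitEnum t) (ψ : F →* kˣ) (p : G × F) :
    orbitMatrix o ψ (basis M p) = Matrix.of fun i j =>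
      if o.pt i = p.1 ∧ o.pt j = M.ract p.1 p.2 then (ψ p.2 : k) else 0 := by
  simp [orbitMatrix]

theorem orbitMatrix_one (o : M.OrbitEnum t) (ψ : F →* kˣ) :
    orbitMatrix o ψ (1 : Bismash k M) = 1 := by
  classical
  rw [one_def, map_sum]
  ext i j
  rw [Matrix.sum_apply]
  simp only [orbitMatrix_basis, Matrix.of_apply, M.ract_one, map_one, Units.val_one]
  rw [Finset.sum_eq_single (o.pt i)]
  · simp [Matrix.one_apply, o.pt_injective.eq_iff, eq_comm]
  · intro b _ hb
    rw [if_neg]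
    exact fun h => hb h.1.symm
  · simp

theorem orbitMatrix_basis_mul (o : M.OrbitEnum t) (ψ : F →* kˣ) (p q : G × F) :
    orbitMatrix o ψ (basis M p * basis M q : Bismash k M) =
      orbitMatrix o ψ (basis M p) * orbitMatrix o ψ (basis M q) := by
  classical
  ext i j
  rw [Matrix.mul_apply, basis_mul_basis]
  simp only [orbitMatrix_basis, Matrix.of_apply]
  by_cases hi : o.pt i = p.1
  · obtain ⟨l, hl⟩ := o.exists_ract i p.2
    rw [hi] at hl
    rw [Finset.sum_eq_single l]
    · split_ifs <;> simp_all [orbitMatrix_basis, M.ract_mul]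
    · intro l' _ hl'
      rw [if_neg, zero_mul]
      exact fun h => hl' (o.pt_injective (h.2.trans hl.symm))
    · simp
  · rw [Finset.sum_eq_zero]
    · split_ifs
      · simp [orbitMatrix_basis, hi]
      · simp
    · intro l _
      rw [if_neg (fun h => hi h.1), zero_mul]

theorem orbitMatrix_mul (o : M.OrbitEnum t) (ψ : F →* kˣ) (u v : Bismash k M) :
    orbitMatrix o ψ (u * v) = orbitMatrix o ψ u * orbitMatrix o ψ v := by
  have h : (LinearMap.mul k (Bismash k M)).compr₂ (orbitMatrix o ψ) =
      (LinearMap.mul k (Matrix (Fin t) (Fin t) k)).compl₁₂ (orbitMatrix o ψ) (orbitMatrix o ψ) :=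
    (basis M).ext fun p => (basis M).ext fun q => orbitMatrix_basis_mul o ψ p q
  exact LinearMap.congr_fun (LinearMap.congr_fun h u) v

/-- The representation of the bismash product on the functions on an orbit that is twisted by a
character of `F`. -/
noncomputable def orbitRep (o : M.OrbitEnum t) (ψ : F →* kˣ) :
    Bismash k M →ₐ[k] Module.End k (Fin t → k) :=
  Matrix.toLinAlgEquiv'.toAlgHom.comp
    (AlgHom.ofLinearMap (orbitMatrix o ψ) (orbitMatrix_one o ψ) (orbitMatrix_mul o ψ))

theorem orbitRep_apply (o : M.OrbitEnum t) (ψ : F →* kˣ) (u : Bismash k M) :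
    orbitRep o ψ u = Matrix.toLin' (orbitMatrix o ψ u) := rfl

open Classical in
theorem orbitRep_basis_apply (o : M.OrbitEnum t) (ψ : F →* kˣ) (p : G × F) (f : Fin t → k)
    (i : Fin t) : orbitRep o ψ (basis M p) f i =
      ∑ j, if o.pt i = p.1 ∧ o.pt j = M.ract p.1 p.2 then (ψ p.2 : k) * f j else 0 := by
  rw [orbitRep_apply, Matrix.toLin'_apply, Matrix.mulVec, dotProduct, orbitMatrix_basis]
  simp [ite_mul]

open Classical in
/-- `p_x # b` moves the value at `x ◁ b` to `x`. -/
theorem orbitRep_basis_apply_of_eq (o : M.OrbitEnum t) (ψ : F →* kˣ) (p : G × F)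
    (f : Fin t → k) {l : Fin t} (hl : o.pt l = M.ract p.1 p.2) (i : Fin t) :
    orbitRep o ψ (basis M p) f i = if o.pt i = p.1 then (ψ p.2 : k) * f l else 0 := by
  rw [orbitRep_basis_apply, Finset.sum_eq_single l]
  · simp [hl]
  · intro j _ hj
    rw [if_neg]
    exact fun h => hj (o.pt_injective (h.2.trans hl.symm))
  · simp

open Classical in
theorem trace_orbitRep_basis (o : M.OrbitEnum t) (ψ : F →* kˣ) (p : G × F) :
    LinearMap.trace k (Fin t → k) (orbitRep o ψ (basis M p)) =
      if p.1 ∈ M.orb o.base ∧ M.ract p.1 p.2 = p.1 then (ψ p.2 : k) else 0 := by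
  rw [orbitRep_apply, Matrix.trace_toLin'_eq, Matrix.trace, orbitMatrix_basis]
  simp only [Matrix.diag_apply, Matrix.of_apply]
  split_ifs with h
  · obtain ⟨i, hi⟩ := o.exists_pt_eq.2 h.1
    rw [Finset.sum_eq_single i]
    · rw [if_pos ⟨hi, by rw [hi, h.2]⟩]
    · intro j _ hj
      rw [if_neg]
      exact fun h' => hj (o.pt_injective (h'.1.trans hi.symm))
    · simp
  · refine Finset.sum_eq_zero fun i _ => if_neg fun hi => h ⟨?_, ?_⟩
    · exact o.exists_pt_eq.1 ⟨i, hi.1⟩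
    · rw [← hi.2, hi.1]

/-- By transitivity, any nonzero value of a vector can be moved to any point j while the values
elsewhere are killed; so a nonzero invariant subspace contains every delta function. -/
theorem isIrreducibleRep_orbitRep (ht : 0 < t) (o : M.OrbitEnum t) (ψ : F →* kˣ) :
    IsIrreducibleRep (orbitRep (k := k) o ψ) := by
  classical
  refine ⟨ht, fun W hW => or_iff_not_imp_left.2 fun hne => ?_⟩
  obtain ⟨w, hw, hw0⟩ := W.ne_bot_iff.1 hne
  obtain ⟨i, hi⟩ := Function.ne_iff.1 hw0
  have key (j : Fin t) : Pi.single j (1 : k) ∈ W := by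
    obtain ⟨b, hb⟩ := M.exists_ract_eq (o.equiv j).2 (o.equiv i).2
    have h := W.smul_mem ((ψ b : k) * w i)⁻¹ (hW (basis M (o.pt j, b)) w hw)
    convert h using 1
    ext l
    rw [Pi.smul_apply, orbitRep_basis_apply_of_eq o ψ (o.pt j, b) w (l := i) hb.symm]
    by_cases hl : l = j
    · subst hl
      simpa using (inv_mul_cancel₀ (mul_ne_zero (ψ b).ne_zero hi)).symm
    · simp [hl, o.pt_injective.eq_iff]
  rw [eq_top_iff, ← (Pi.basisFun k (Fin t)).span_eq, Submodule.span_le]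
  rintro _ ⟨j, rfl⟩
  simpa using key j

/-- The group element `∑ p_y # b`. -/
noncomputable def groupElt (M : MatchedPair F G) : F →* Bismash k M where
  toFun b := ∑ y : G, basis M (y, b)
  map_one' := rfl
  map_mul' a b := by
    classical
    rw [Finset.sum_mul]
    refine Finset.sum_congr rfl fun y _ => ?_
    rw [Finset.mul_sum]
    simp [basis_mul_basis]

theorem groupElt_apply (b : F) : groupElt (k := k) M b = ∑ y : G, basis M (y, b) := rfl

theorem basis_mul_groupElt (x : G) (a b : F) :
    basis M (x, a) * groupElt (k := k) M b = basis M (x, a * b) := by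
  classical
  rw [groupElt_apply, Finset.mul_sum]
  simp [basis_mul_basis]

end Bismash

/-! ### An eigenvector of F identifies an irreducible representation -/

namespace Bismash

section Eigenvector

variable {k : Type*} [Field k] {F G : Type*} [Group F] [Group G] [Fintype G]
  {M : MatchedPair F G} {t : ℕ}
  {ρ : Bismash k M →ₐ[k] Module.End k (Fin t → k)} {ψ : F →* kˣ} {w : Fin t → k}
  (hw : ∀ b, ρ (groupElt M b) w = (ψ b : k) • w)

include hw

theorem rep_basis_apply_eigenvector (x : G) (b : F) :
    ρ (basis M (x, b)) w = (ψ b : k) • ρ (basis M (x, 1)) w := by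
  have := basis_mul_groupElt (k := k) (M := M) x 1 b
  rw [one_mul] at this
  rw [← this, map_mul, Module.End.mul_apply, hw, map_smul]

open Classical in
theorem rep_basis_apply_component (x y : G) (b : F) :
    ρ (basis M (x, b)) (ρ (basis M (y, 1)) w) =
      if y = M.ract x b then (ψ b : k) • ρ (basis M (x, 1)) w else 0 := by
  rw [← Module.End.mul_apply, ← map_mul, basis_mul_basis]
  dsimp only
  split_ifs
  · rw [mul_one, rep_basis_apply_eigenvector hw]
  · simp

theorem component_ne_zero {z y : G} (hz : ρ (basis M (z, 1)) w ≠ 0) (hy : y ∈ M.orb z) :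
    ρ (basis M (y, 1)) w ≠ 0 := by
  obtain ⟨b, rfl⟩ := hy
  intro h0
  have h := rep_basis_apply_component hw z (M.ract z b) b
  dsimp only at h0
  rw [if_pos rfl, h0, map_zero] at h
  exact smul_ne_zero (ψ b).ne_zero hz h.symm

/-- The `p_y # 1` are orthogonal idempotents, so nonzero components of w are independent. -/
theorem linearIndependent_component {z : G} (hz : ρ (basis M (z, 1)) w ≠ 0) :
    LinearIndependent k fun y : M.orb z => ρ (basis M (y, 1)) w := by
  classical
  rw [linearIndependent_iff']
  intro s g hg y hy
  have h := congrArg (ρ (basis M ((y : G), 1))) hg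
  rw [map_zero, map_sum] at h
  simp only [map_smul, rep_basis_apply_component hw, M.ract_one, map_one, Units.val_one,
    one_smul] at h
  rw [Finset.sum_eq_single y] at h
  · rw [if_pos rfl] at h
    exact (smul_eq_zero.1 h).resolve_right (component_ne_zero hw hz y.2)
  · intro x _ hx
    rw [if_neg (fun h => hx (Subtype.ext h)), smul_zero]
  · exact fun h => absurd hy h

/-- Each `p_x # b` sends a component of w to zero or to a multiple of another component in the same
orbit, so the span is a nonzero invariant subspace. -/
theorem span_component_eq_top (hρ : IsIrreducibleRep ρ) {z : G}
    (hz : ρ (basis M (z, 1)) w ≠ 0) :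
    Submodule.span k (Set.range fun y : M.orb z => ρ (basis M (y, 1)) w) = ⊤ := by
  classical
  set W := Submodule.span k (Set.range fun y : M.orb z => ρ (basis M (y, 1)) w) with hW
  refine (hρ.2 W ?_).resolve_left ?_
  · intro a v hv
    suffices h : ∀ v ∈ W, ∀ a : Bismash k M, ρ a v ∈ W from h v hv a
    clear hv v a
    intro v hv a
    have ha := (basis (k := k) M).mem_span a
    induction ha using Submodule.span_induction with
    | mem a h =>
      obtain ⟨⟨x, b⟩, rfl⟩ := h
      suffices hle : W ≤ W.comap (ρ (basis M (x, b))) from hle hv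
      rw [hW, Submodule.span_le]
      rintro _ ⟨y, rfl⟩
      change ρ (basis M (x, b)) (ρ (basis M ((y : G), 1)) w) ∈ W
      rw [rep_basis_apply_component hw]
      split_ifs with hy
      · refine W.smul_mem _ (Submodule.subset_span ⟨⟨x, ?_⟩, rfl⟩)
        rw [← M.ract_mem_orb_iff b, ← hy]
        exact y.2
      · exact W.zero_mem
    | zero => simp
    | add a b _ _ ha hb => rw [map_add]; exact W.add_mem ha hb
    | smul c a _ ha => rw [map_smul]; exact W.smul_mem c ha
  · intro hbot
    refine hz ((Submodule.mem_bot k).1 ?_)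
    rw [← hbot]
    exact Submodule.subset_span ⟨⟨z, M.mem_orb_self z⟩, rfl⟩

theorem card_orb_eq_of_eigenvector (hρ : IsIrreducibleRep ρ) {z : G}
    (hz : ρ (basis M (z, 1)) w ≠ 0) : Nat.card (M.orb z) = t := by
  have h := Module.finrank_eq_nat_card_basis (Module.Basis.mk (linearIndependent_component hw hz)
    (span_component_eq_top hw hρ hz).ge)
  rw [← h]
  simp

/-- The intertwiner sends the delta function at y to `p_y w`. -/
theorem exists_equiv_orbitRep (hρ : IsIrreducibleRep ρ) (o : M.OrbitEnum t)
    (hz : ρ (basis M (o.base, 1)) w ≠ 0) :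
    ∃ e : (Fin t → k) ≃ₗ[k] (Fin t → k), ∀ a v, e (orbitRep o ψ a v) = ρ a (e v) := by
  classical
  let B : Module.Basis (Fin t) k (Fin t → k) :=
    (Module.Basis.mk (linearIndependent_component hw hz)
      (span_component_eq_top hw hρ hz).ge).reindex o.equiv.symm
  have hB (i : Fin t) : B i = ρ (basis M (o.pt i, 1)) w := by
    simp [B, MatchedPair.OrbitEnum.pt]
  refine ⟨B.equivFun.symm, fun a v => ?_⟩
  suffices h : (LinearMap.mul k (Module.End k (Fin t → k)) B.equivFun.symm.toLinearMap) ∘ₗ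
      (orbitRep o ψ).toLinearMap = ((LinearMap.mul k (Module.End k (Fin t → k))).flip
        B.equivFun.symm.toLinearMap) ∘ₗ ρ.toLinearMap from
    LinearMap.congr_fun (LinearMap.congr_fun h a) v
  refine (basis M).ext fun p => LinearMap.ext fun f => ?_
  change B.equivFun.symm (orbitRep o ψ (basis M p) f) = ρ (basis M p) (B.equivFun.symm f)
  obtain ⟨x, b⟩ := p
  rw [Module.Basis.equivFun_symm_apply, Module.Basis.equivFun_symm_apply, map_sum]
  simp only [hB, map_smul, rep_basis_apply_component hw]
  by_cases hx : ∃ l, o.pt l = M.ract x b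
  · obtain ⟨l, hl⟩ := hx
    have hx' : x ∈ M.orb o.base := by
      rw [← M.ract_mem_orb_iff b, ← hl]
      exact (o.equiv l).2
    obtain ⟨i, rfl⟩ := o.exists_pt_eq.2 hx'
    simp only [fun j => orbitRep_basis_apply_of_eq o ψ (o.pt i, b) f hl j]
    rw [Finset.sum_eq_single i, Finset.sum_eq_single l, if_pos rfl, if_pos hl, smul_smul, mul_comm]
    · intro j _ hj
      rw [if_neg (fun h => hj (o.pt_injective (h.trans hl.symm))), smul_zero]
    · simp
    · intro j _ hj
      rw [if_neg (fun h => hj (o.pt_injective h)), zero_smul]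
    · simp
  · push Not at hx
    rw [Finset.sum_eq_zero, Finset.sum_eq_zero]
    · intro j _
      rw [if_neg (hx j), smul_zero]
    · intro i _
      rw [orbitRep_basis_apply, Finset.sum_eq_zero, zero_smul]
      intro j _
      rw [if_neg (fun h => hx j h.2)]

end Eigenvector

variable {k : Type*} [Field k] {F G : Type*} [Group F] [Group G] [Fintype G]
  {M : MatchedPair F G} {t : ℕ}

theorem exists_component_ne_zero (ρ : Bismash k M →ₐ[k] Module.End k (Fin t → k))
    {w : Fin t → k} (hw : w ≠ 0) : ∃ z, ρ (basis M (z, 1)) w ≠ 0 := by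
  by_contra! h
  apply hw
  have h1 : ρ 1 w = w := by rw [map_one, Module.End.one_apply]
  rw [← h1, one_def, map_sum, LinearMap.sum_apply]
  exact Finset.sum_eq_zero fun z _ => h z

/-- For cyclic `F` every nonzero representation has a vector on which `F` acts by a character. -/
theorem exists_eigenvector [IsAlgClosed k] [Finite F] [IsCyclic F] (ht : 0 < t)
    (ρ : Bismash k M →ₐ[k] Module.End k (Fin t → k)) :
    ∃ (w : Fin t → k) (ψ : F →* kˣ), w ≠ 0 ∧ ∀ b, ρ (groupElt M b) w = (ψ b : k) • w := by
  have : Nonempty (Fin t) := ⟨⟨0, ht⟩⟩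
  obtain ⟨g, hg⟩ := IsCyclic.exists_monoid_generator (α := F)
  obtain ⟨μ, hμ⟩ := Module.End.exists_eigenvalue (ρ (groupElt M g))
  obtain ⟨w, hw⟩ := hμ.exists_hasEigenvector
  have h (b : F) : ∃ c : k, ρ (groupElt M b) w = c • w := by
    obtain ⟨j, rfl⟩ := hg b
    refine ⟨μ ^ j, ?_⟩
    dsimp only
    rw [map_pow, map_pow, hw.pow_apply]
  choose c hc using h
  have hinj {c d : k} (h : c • w = d • w) : c = d := smul_left_injective k hw.2 h
  let φ : F →* k :=
    { toFun := c
      map_one' := hinj (by rw [← hc, map_one, map_one, Module.End.one_apply, one_smul])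
      map_mul' := fun a b => hinj (by
        rw [← hc, map_mul, map_mul, Module.End.mul_apply, hc b, map_smul, hc a, smul_smul,
          mul_comm]) }
  exact ⟨w, φ.toHomUnits, hw.2, fun b => by rw [hc]; rfl⟩

theorem groupElt_orbitRep_apply (o : M.OrbitEnum t) (ψ : F →* kˣ) (b : F) (f : Fin t → k)
    {i l : Fin t} (hl : o.pt l = M.ract (o.pt i) b) :
    orbitRep o ψ (groupElt M b) f i = (ψ b : k) * f l := by
  classical
  rw [groupElt_apply, map_sum, LinearMap.sum_apply, Finset.sum_apply,
    Finset.sum_eq_single (o.pt i)]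
  · rw [orbitRep_basis_apply_of_eq o ψ (o.pt i, b) f hl, if_pos rfl]
  · intro y _ hy
    rw [orbitRep_basis_apply]
    exact Finset.sum_eq_zero fun j _ => if_neg fun h => hy h.1.symm
  · simp

/-- Twisting by a character that is trivial on the stabilizer does not change the
representation. -/
theorem exists_equiv_orbitRep_of_eqOn (ht : 0 < t) (o o' : M.OrbitEnum t) (ψ ψ' : F →* kˣ)
    (ho : o'.base ∈ M.orb o.base) (hψ : ∀ b ∈ M.stab o.base, ψ b = ψ' b) :
    ∃ e : (Fin t → k) ≃ₗ[k] (Fin t → k),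
      ∀ a v, e (orbitRep o ψ a v) = orbitRep o' ψ' a (e v) := by
  classical
  have hb (i : Fin t) : ∃ b, M.ract o.base b = o'.pt i := by
    have : o'.pt i ∈ M.orb o'.base := (o'.equiv i).2
    rwa [M.orb_eq_of_mem ho] at this
  choose c hc using hb
  -- This is ψ/ψ' transported to the orbit, where c i carries the base point to the i-th point. As
  -- ψ/ψ' is trivial on the stabilizer, w is an F-eigenvector with character ψ inside the
  -- representation twisted by ψ'.
  let w : Fin t → k := fun i => ((ψ (c i) / ψ' (c i) : kˣ) : k)
  refine exists_equiv_orbitRep (w := w) ?_ (isIrreducibleRep_orbitRep ht o' ψ') o ?_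
  · intro b
    ext i
    obtain ⟨l, hl⟩ := o'.exists_ract i b
    rw [groupElt_orbitRep_apply o' ψ' b w hl, Pi.smul_apply, smul_eq_mul]
    have hs : c i * b * (c l)⁻¹ ∈ M.stab o.base := by
      rw [← M.ract_eq_ract_iff, M.ract_mul, hc, hc, hl]
    have h := hψ _ hs
    simp only [map_mul, map_inv] at h
    simp only [w]
    rw [← Units.val_mul, ← Units.val_mul]
    congr 1
    rw [mul_div_assoc', mul_div_assoc', div_eq_div_iff_mul_eq_mul]
    rw [mul_inv_eq_iff_eq_mul] at h
    rw [mul_comm (ψ b), h]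
    simp only [mul_assoc, mul_comm, mul_left_comm]
    simp [mul_comm]
  · obtain ⟨i, hi⟩ := o'.exists_pt_eq.2 (M.mem_orb_symm ho)
    intro h0
    have h := congrFun h0 i
    rw [orbitRep_basis_apply_of_eq o' ψ' (o.base, 1) w (l := i)
      (by rw [hi]; exact (M.ract_one _).symm), if_pos hi] at h
    simp [w] at h

end Bismash

/-! ### Classification of the irreducibles, and their indicators -/

namespace Bismash

variable {k : Type*} [Field k] {F G : Type*} [Group F] [Group G] [Fintype G]
  {t : ℕ}

/-- The isomorphism class of the irreducible representation attached to a point whose orbit has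
`t` elements and to a character of `F`. -/
noncomputable def orbitIrrep [Finite F] (M : MatchedPair F G) (ht : 0 < t)
    (x : {z : G // Nat.card (M.orb z) = t} × (F →* kˣ)) : Irrep k (Bismash k M) t :=
  Quotient.mk (irrepSetoid k (Bismash k M) t)
    ⟨orbitRep (M.orbitEnum x.1) x.2, isIrreducibleRep_orbitRep ht _ _⟩

open Classical in
theorem character_orbitIrrep [Finite F] {M : MatchedPair F G} (ht : 0 < t)
    (x : {z : G // Nat.card (M.orb z) = t} × (F →* kˣ)) (p : G × F) :
    (orbitIrrep M ht x).character (basis M p) =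
      if p.1 ∈ M.orb x.1 ∧ M.ract p.1 p.2 = p.1 then (x.2 p.2 : k) else 0 :=
  trace_orbitRep_basis (M.orbitEnum x.1) x.2 p

theorem orbitIrrep_surjective [IsAlgClosed k] [Finite F] [IsCyclic F] (M : MatchedPair F G)
    (ht : 0 < t) : Function.Surjective (orbitIrrep (k := k) M ht) := by
  intro V
  induction V using Quotient.inductionOn with
  | h ρ =>
    obtain ⟨w, ψ, hw0, hw⟩ := exists_eigenvector ht ρ.1
    obtain ⟨z, hz⟩ := exists_component_ne_zero ρ.1 hw0
    exact ⟨(⟨z, card_orb_eq_of_eigenvector hw ρ.2 hz⟩, ψ),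
      Quotient.sound (exists_equiv_orbitRep hw ρ.2 (M.orbitEnum ⟨z, _⟩) hz)⟩

/-- The character recovers the data: its value on `p_y # 1` detects the orbit, and its values on
`p_z # b` with b stabilizing z give ψ on the stabilizer. -/
theorem orbitIrrep_eq_iff [Finite F] {M : MatchedPair F G} (ht : 0 < t)
    (x y : {z : G // Nat.card (M.orb z) = t} × (F →* kˣ)) :
    orbitIrrep M ht x = orbitIrrep M ht y ↔
      (y.1 : G) ∈ M.orb x.1 ∧ ∀ b ∈ M.stab x.1, x.2 b = y.2 b := by
  classical
  constructor
  · intro h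
    have hchar (p : G × F) := congrArg (fun V => V.character (basis M p)) h
    simp only [character_orbitIrrep] at hchar
    have hmem : (y.1 : G) ∈ M.orb x.1 := by
      have h1 := hchar (x.1, 1)
      rw [if_pos ⟨M.mem_orb_self _, M.ract_one _⟩] at h1
      by_contra hn
      rw [if_neg (fun h => hn (M.mem_orb_symm h.1))] at h1
      exact (x.2 1).ne_zero h1
    refine ⟨hmem, fun b hb => ?_⟩
    have h1 := hchar (x.1, b)
    rw [if_pos ⟨M.mem_orb_self _, hb⟩, if_pos ⟨M.mem_orb_symm hmem, hb⟩] at h1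
    exact Units.ext h1
  · rintro ⟨h1, h2⟩
    exact Quotient.sound (exists_equiv_orbitRep_of_eqOn ht _ _ _ _ h1 h2)

/-- The fibres of `orbitIrrep`. -/
noncomputable def orbitIrrepFiberEquiv [Finite F] {M : MatchedPair F G} (ht : 0 < t)
    (x : {z : G // Nat.card (M.orb z) = t} × (F →* kˣ)) :
    {y // orbitIrrep M ht y = orbitIrrep M ht x} ≃
      M.orb x.1 × {χ : F →* kˣ // ∀ b ∈ M.stab x.1, χ b = 1} where
  toFun y := (⟨y.1.1, ((orbitIrrep_eq_iff ht x y.1).1 y.2.symm).1⟩,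
    ⟨y.1.2 / x.2, fun b hb => by
      rw [MonoidHom.div_apply, div_eq_one]
      exact (((orbitIrrep_eq_iff ht x y.1).1 y.2.symm).2 b hb).symm⟩)
  invFun y := ⟨(⟨y.1.1, by rw [M.orb_eq_of_mem y.1.2, x.1.2]⟩, y.2.1 * x.2), by
    rw [eq_comm, orbitIrrep_eq_iff]
    exact ⟨y.1.2, fun b hb => by
      rw [MonoidHom.mul_apply, y.2.2 b hb, one_mul]⟩⟩
  left_inv y := Subtype.ext (Prod.ext rfl (div_mul_cancel y.1.2 x.2))
  right_inv y := Prod.ext rfl (Subtype.ext (mul_div_cancel_right y.2.1 x.2))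

/-- A fibre has t times as many elements as there are characters of F trivial on the stabilizer, and
orbits of equal size have the same stabilizer in a cyclic group. -/
theorem card_orbitIrrep_fiber_eq [Finite F] [IsCyclic F] {M : MatchedPair F G} (ht : 0 < t)
    (x y : {z : G // Nat.card (M.orb z) = t} × (F →* kˣ)) :
    Nat.card {u // orbitIrrep M ht u = orbitIrrep M ht x} =
      Nat.card {u // orbitIrrep M ht u = orbitIrrep M ht y} := by
  rw [Nat.card_congr (orbitIrrepFiberEquiv ht x), Nat.card_congr (orbitIrrepFiberEquiv ht y),
    Nat.card_prod, Nat.card_prod, x.1.2, y.1.2,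
    M.stab_eq_of_card_orb_eq (x.1.2.trans y.1.2.symm)]

/-- Expansion of Δ Λ. The linear form f is the character; it is bundled so that sums and scalars can
be pulled out. -/
theorem indicator_eq_sum [Fintype F] {M : MatchedPair F G} (V : Irrep k (Bismash k M) t) :
    ∃ f : Bismash k M →ₗ[k] k, (∀ a, f a = V.character a) ∧
      indicator V = (Fintype.card F : k)⁻¹ * ∑ a : F, ∑ y : G,
        f (basis M (y⁻¹, M.lact y a) * basis M (y, a)) := by
  induction V using Quotient.inductionOn with
  | h ρ =>
    refine ⟨LinearMap.trace k (Fin t → k) ∘ₗ ρ.1.toLinearMap, fun a => rfl, ?_⟩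
    change (LinearMap.trace k (Fin t → k) ∘ₗ ρ.1.toLinearMap) _ = _
    rw [integral, map_smul, map_smul, map_smul, smul_eq_mul, map_sum, map_sum, map_sum]
    congr 1
    refine Finset.sum_congr rfl fun a _ => ?_
    rw [comul_basis, map_sum, map_sum]
    simp

/-- A nonzero indicator forces the orbit to contain a point together with its inverse. -/
theorem exists_inv_mem_of_indicator_ne_zero [Fintype F] {M : MatchedPair F G} (ht : 0 < t)
    (x : {z : G // Nat.card (M.orb z) = t} × (F →* kˣ))
    (h : indicator (orbitIrrep M ht x) ≠ 0) : ∃ y ∈ M.orb x.1, y⁻¹ ∈ M.orb x.1 := by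
  classical
  obtain ⟨f, hf, hsum⟩ := indicator_eq_sum (orbitIrrep M ht x)
  rw [hsum] at h
  obtain ⟨a, _, ha⟩ := Finset.exists_ne_zero_of_sum_ne_zero (right_ne_zero_of_mul h)
  obtain ⟨y, _, hy⟩ := Finset.exists_ne_zero_of_sum_ne_zero ha
  rw [basis_mul_basis] at hy
  dsimp only at hy
  -- A nonzero product makes y a translate of y⁻¹, and a nonzero character value places y⁻¹ in the
  -- orbit.
  by_cases hc : y = M.ract y⁻¹ (M.lact y a)
  · rw [if_pos hc, hf, character_orbitIrrep] at hy
    have hm : y⁻¹ ∈ M.orb x.1 := by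
      by_contra hn
      exact hy (if_neg fun h' => hn h'.1)
    refine ⟨y, ?_, hm⟩
    rw [hc]
    exact M.ract_mem_orb _ hm
  · rw [if_neg hc, map_zero] at hy
    exact absurd rfl hy

theorem finite_irrep [IsAlgClosed k] [Finite F] [IsCyclic F] (M : MatchedPair F G)
    (ht : 0 < t) : Finite (Irrep k (Bismash k M) t) :=
  Finite.of_surjective _ (orbitIrrep_surjective M ht)

theorem card_eq_mul_of_card_fiber {α β : Type*} [Finite α] [Finite β] (f : α → β) (c : ℕ)
    (p : β → Prop) (hc : ∀ b, Nat.card {a // f a = b} = c) :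
    Nat.card {a // p (f a)} = c * Nat.card {b // p b} := by
  classical
  have := Fintype.ofFinite {b // p b}
  let e : {a // p (f a)} ≃ Σ b : {b // p b}, {a // f a = b} :=
    { toFun := fun a => ⟨⟨f a, a.2⟩, ⟨a, rfl⟩⟩
      invFun := fun x => ⟨x.2.1, by rw [x.2.2]; exact x.1.2⟩
      left_inv := fun a => rfl
      right_inv := fun ⟨⟨b, hb⟩, ⟨a, ha⟩⟩ => by
        dsimp only at ha
        subst ha
        rfl }
  rw [Nat.card_congr e, Nat.card_sigma]
  simp [hc, mul_comm]

/-- The proportion of irreducible representations with indicator `1` is at most the proportion of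
points whose orbit contains a point together with its inverse. -/
theorem card_indicator_eq_one_mul_le [IsAlgClosed k] [Fintype F] [IsCyclic F]
    (M : MatchedPair F G) (ht : 0 < t) :
    Nat.card {V : Irrep k (Bismash k M) t // indicator V = 1} *
        Nat.card {z : G // Nat.card (M.orb z) = t} ≤
      Nat.card {z : G // Nat.card (M.orb z) = t ∧ ∃ y ∈ M.orb z, y⁻¹ ∈ M.orb z} *
        Nat.card (Irrep k (Bismash k M) t) := by
  have := finite_irrep (k := k) M ht
  rcases isEmpty_or_nonempty {z : G // Nat.card (M.orb z) = t} with hE | ⟨⟨z₀⟩⟩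
  · rw [Nat.card_of_isEmpty (α := {z : G // Nat.card (M.orb z) = t}), mul_zero]
    exact Nat.zero_le _
  let x₀ : {z : G // Nat.card (M.orb z) = t} × (F →* kˣ) := (z₀, 1)
  set c := Nat.card {u // orbitIrrep M ht u = orbitIrrep M ht x₀} with hc
  have hfib (V : Irrep k (Bismash k M) t) : Nat.card {u // orbitIrrep M ht u = V} = c := by
    obtain ⟨x, rfl⟩ := orbitIrrep_surjective M ht V
    exact card_orbitIrrep_fiber_eq ht x x₀
  have hcpos : 0 < c := by
    have : Nonempty {u // orbitIrrep M ht u = orbitIrrep M ht x₀} := ⟨⟨x₀, rfl⟩⟩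
    exact Nat.card_pos
  have hone := card_eq_mul_of_card_fiber (orbitIrrep M ht) c (fun V => indicator V = (1 : k)) hfib
  have hall := card_eq_mul_of_card_fiber (orbitIrrep M ht) c (fun _ => True) hfib
  rw [Nat.card_congr (Equiv.subtypeUnivEquiv fun _ => trivial),
    Nat.card_congr (Equiv.subtypeUnivEquiv fun _ => trivial), Nat.card_prod] at hall
  -- The condition on the orbit does not involve ψ, so every character of F is allowed. The common
  -- fibre size c and the number of characters cancel at the end.
  have hle : Nat.card {x // indicator (orbitIrrep (k := k) M ht x) = 1} ≤
      Nat.card {z : G // Nat.card (M.orb z) = t ∧ ∃ y ∈ M.orb z, y⁻¹ ∈ M.orb z} *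
        Nat.card (F →* kˣ) := by
    rw [← Nat.card_prod]
    refine Nat.card_le_card_of_injective (fun x => (⟨x.1.1, x.1.1.2,
      exists_inv_mem_of_indicator_ne_zero ht x.1 (by rw [x.2]; exact one_ne_zero)⟩, x.1.2)) ?_
    intro x y h
    simp only [Prod.mk.injEq, Subtype.mk.injEq] at h
    exact Subtype.ext (Prod.ext (Subtype.ext h.1) h.2)
  rw [hone] at hle
  have hN : 0 < Nat.card (F →* kˣ) := Nat.card_pos
  refine Nat.le_of_mul_le_mul_left ?_ (mul_pos hcpos hN)
  calc _ = (c * Nat.card {V : Irrep k (Bismash k M) t // indicator V = 1}) *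
        (Nat.card {z : G // Nat.card (M.orb z) = t} * Nat.card (F →* kˣ)) := by ring
    _ ≤ _ := Nat.mul_le_mul_right _ hle
    _ = _ := by rw [hall]; ring

end Bismash

/-! ### Permutations of ℤ/mt with prescribed translation behaviour -/

namespace ZModPerm

/-- `c` is a period of the permutation `z` of `ℤ/n` if `z` turns the translation by `c` into the
translation by `z c`. -/
def IsPeriod {n : ℕ} (z : Equiv.Perm (ZMod n)) (c : ZMod n) : Prop :=
  ∀ i, z (i + c) = z i + z c

/-- The subgroup of periods of a permutation that fixes `0`. -/
def periods {n : ℕ} (z : Equiv.Perm (ZMod n)) (hz : z 0 = 0) : AddSubgroup (ZMod n) where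
  carrier := {c | IsPeriod z c}
  zero_mem' := fun i => by rw [add_zero, hz, add_zero]
  add_mem' {a b} ha hb := fun i => by
    rw [← add_assoc, hb, ha, hb a, add_assoc]
  neg_mem' {a} ha := fun i => by
    have h1 := ha (i + -a)
    have h2 := ha (-a)
    rw [neg_add_cancel_right] at h1
    rw [neg_add_cancel, hz] at h2
    rw [h1, add_assoc, add_comm (z a), ← h2, add_zero]

theorem mem_periods {n : ℕ} {z : Equiv.Perm (ZMod n)} {hz : z 0 = 0} {c : ZMod n} :
    c ∈ periods z hz ↔ IsPeriod z c := Iff.rfl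

variable {m t : ℕ}

/-- Reduction modulo `t` of residues modulo `m t`. -/
def red (m t : ℕ) : ZMod (m * t) →+* ZMod t := ZMod.castHom (dvd_mul_left t m) (ZMod t)

theorem red_natCast_mul (w : ZMod (m * t)) : red m t ((t : ZMod (m * t)) * w) = 0 := by
  rw [map_mul, map_natCast, ZMod.natCast_self, zero_mul]

theorem red_eq_zero_iff [NeZero (m * t)] (c : ZMod (m * t)) : red m t c = 0 ↔ t ∣ c.val := by
  rw [← ZMod.natCast_eq_zero_iff, ← map_natCast (red m t), ZMod.natCast_zmod_val]

/-- Multiplication by `t` from residues modulo `m` to residues modulo `m t`. -/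
def scale (m t : ℕ) (x : ZMod m) : ZMod (m * t) := ((t * x.val : ℕ) : ZMod (m * t))

theorem natCast_mul_eq_iff (ht : 0 < t) (a b : ℕ) :
    ((t * a : ℕ) : ZMod (m * t)) = ((t * b : ℕ) : ZMod (m * t)) ↔ (a : ZMod m) = b := by
  rw [ZMod.natCast_eq_natCast_iff, ZMod.natCast_eq_natCast_iff, mul_comm m t]
  exact ⟨fun h => Nat.ModEq.mul_left_cancel' ht.ne' h, fun h => h.mul_left' t⟩

theorem scale_natCast [NeZero m] (ht : 0 < t) (j : ℕ) :
    scale m t (j : ZMod m) = (t : ZMod (m * t)) * j := by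
  rw [scale, ← Nat.cast_mul, natCast_mul_eq_iff ht, ZMod.natCast_zmod_val]

theorem scale_injective [NeZero m] (ht : 0 < t) : Function.Injective (scale m t) := by
  intro x y h
  rw [scale, scale, natCast_mul_eq_iff ht, ZMod.natCast_zmod_val, ZMod.natCast_zmod_val] at h
  exact h

theorem apply_add_natCast_mul {v : ZMod (m * t)} {z : Equiv.Perm (ZMod (m * t))}
    (hv : ∀ i, z (i + t) = z i + v) (j : ℕ) (i : ZMod (m * t)) :
    z (i + t * j) = z i + v * j := by
  induction j with
  | zero => simp
  | succ j ih => rw [Nat.cast_succ, mul_add, mul_one, ← add_assoc, hv, ih, mul_add, mul_one,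
      add_assoc]

theorem apply_natCast_mul {v : ZMod (m * t)} {z : Equiv.Perm (ZMod (m * t))} (hz : z 0 = 0)
    (hv : ∀ i, z (i + t) = z i + v) (j : ℕ) : z (t * j) = v * j := by
  have := apply_add_natCast_mul hv j 0
  rwa [zero_add, hz, zero_add] at this

/-- The permutations fixing `0` that turn the translation by `t` into the translation by `v`. -/
def Twist (m t : ℕ) (v : ZMod (m * t)) :=
  {z : Equiv.Perm (ZMod (m * t)) // z 0 = 0 ∧ ∀ i, z (i + t) = z i + v}

/-- Those permutations in `Twist m t v` all of whose periods are multiples of `t`. -/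
def ExactTwist (m t : ℕ) (v : ZMod (m * t)) :=
  {z : Equiv.Perm (ZMod (m * t)) //
    (z 0 = 0 ∧ ∀ i, z (i + t) = z i + v) ∧ ∀ c, IsPeriod z c → red m t c = 0}

section

variable [NeZero (m * t)]

instance (v : ZMod (m * t)) : Finite (Twist m t v) := Subtype.finite

instance (v : ZMod (m * t)) : Finite (ExactTwist m t v) := Subtype.finite

/-- For a fixed y in `Twist m t v`, the map z ↦ y⁻¹z lands among the permutations commuting with
translation by t. -/
theorem card_twist_le (v : ZMod (m * t)) :
    Nat.card (Twist m t v) ≤ Nat.card (Twist m t (t : ZMod (m * t))) := by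
  rcases isEmpty_or_nonempty (Twist m t v) with hE | ⟨⟨y, hy0, hy⟩⟩
  · rw [Nat.card_of_isEmpty]
    exact Nat.zero_le _
  have hinv (x : ZMod (m * t)) : y⁻¹ (x + v) = y⁻¹ x + t := by
    rw [Equiv.Perm.inv_eq_iff_eq, hy]
    exact congrArg (· + v) (y.apply_symm_apply x).symm
  refine Nat.card_le_card_of_injective
    (fun z : Twist m t v => (⟨y⁻¹ * z.1, ?_, fun i => ?_⟩ : Twist m t (t : ZMod (m * t)))) ?_
  · rw [Equiv.Perm.mul_apply, z.2.1, Equiv.Perm.inv_eq_iff_eq, hy0]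
  · rw [Equiv.Perm.mul_apply, z.2.2, hinv, Equiv.Perm.mul_apply]
  · intro a b h
    exact Subtype.ext (mul_left_cancel (congrArg Subtype.val h))

/-- A unit modulo m lifts to a unit u' modulo mt, and multiplying the values of z by u' turns the
translation t into u't = tu. -/
theorem card_twist_scale_unit [NeZero m] (ht : 0 < t) (u : (ZMod m)ˣ) :
    Nat.card (Twist m t (t : ZMod (m * t))) ≤ Nat.card (Twist m t (scale m t u)) := by
  obtain ⟨u', rfl⟩ := ZMod.unitsMap_surjective (dvd_mul_right m t) u
  have hu : (u' : ZMod (m * t)) * t =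
      scale m t (ZMod.unitsMap (dvd_mul_right m t) u' : (ZMod m)ˣ) := by
    have : ((ZMod.unitsMap (dvd_mul_right m t) u' : (ZMod m)ˣ) : ZMod m) =
        (((u' : ZMod (m * t)).val : ℕ) : ZMod m) := by
      rw [ZMod.unitsMap_val, ZMod.natCast_val]
    rw [this, scale_natCast ht, ZMod.natCast_zmod_val]
    exact mul_comm _ _
  refine Nat.card_le_card_of_injective
    (fun z : Twist m t (t : ZMod (m * t)) => (⟨Units.mulLeft u' * z.1, ?_, fun i => ?_⟩ :
      Twist m t (scale m t (ZMod.unitsMap (dvd_mul_right m t) u' : (ZMod m)ˣ)))) ?_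
  · change (u' : ZMod (m * t)) * z.1 0 = 0
    rw [z.2.1, mul_zero]
  · change (u' : ZMod (m * t)) * z.1 (i + t) = u' * z.1 i + _
    rw [z.2.2, mul_add, hu]
  · intro a b h
    exact Subtype.ext (mul_left_cancel (congrArg Subtype.val h))

end

/-- The permutation that moves the residue class of `1` modulo `t` by `t w`. -/
def shiftOne (m t : ℕ) (w : ZMod (m * t)) : Equiv.Perm (ZMod (m * t)) where
  toFun i := if red m t i = 1 then i + t * w else i
  invFun i := if red m t i = 1 then i - t * w else i
  left_inv i := by
    dsimp only
    by_cases h : red m t i = 1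
    · simp [h, red_natCast_mul]
    · simp [h]
  right_inv i := by
    dsimp only
    by_cases h : red m t i = 1
    · simp [h, red_natCast_mul]
    · simp [h]

theorem shiftOne_apply (w i : ZMod (m * t)) :
    shiftOne m t w i = if red m t i = 1 then i + t * w else i := rfl

theorem shiftOne_add (w w' : ZMod (m * t)) :
    shiftOne m t (w + w') = shiftOne m t w * shiftOne m t w' := by
  ext1 i
  rw [Equiv.Perm.mul_apply]
  simp only [shiftOne_apply]
  by_cases h : red m t i = 1
  · simp [h, red_natCast_mul]
    ring
  · simp [h]

theorem shiftOne_add_natCast (w i : ZMod (m * t)) :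
    shiftOne m t w (i + t) = shiftOne m t w i + t := by
  have : red m t (i + t) = red m t i := by simp
  simp only [shiftOne_apply, this]
  split_ifs <;> ring

theorem shiftOne_zero (ht1 : t ≠ 1) (w : ZMod (m * t)) : shiftOne m t w 0 = 0 := by
  rw [shiftOne_apply, if_neg]
  rw [map_zero]
  intro h
  have := (ZMod.subsingleton_iff (n := t)).1 (subsingleton_of_zero_eq_one h)
  exact ht1 this

/-- Shifting a single residue class modulo t is incompatible with a period s that moves that class,
unless the shift is trivial. Hence one s cannot be a period both before and after a nontrivial
shift. -/
theorem mul_eq_zero_of_isPeriod (ht : Odd t) {z : Equiv.Perm (ZMod (m * t))}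
    {w s : ZMod (m * t)} (hs : red m t s ≠ 0) (h1 : IsPeriod z s)
    (h2 : IsPeriod (z * shiftOne m t w) s) : (t : ZMod (m * t)) * w = 0 := by
  have key (i : ZMod (m * t)) : z (shiftOne m t w (i + s)) + z s =
      z (shiftOne m t w i + s) + z (shiftOne m t w s) := by
    have := h2 i
    simp only [Equiv.Perm.mul_apply] at this
    rw [this, h1]
    ring
  -- Since 2 is invertible modulo the odd t, both 1 + s and 1 + 2s lie outside the class of 1 and
  -- are not shifted.
  have h2s : red m t s + red m t s ≠ 0 := by
    intro h0
    apply hs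
    have h2u : IsUnit ((2 : ℕ) : ZMod t) :=
      (ZMod.isUnit_iff_coprime 2 t).2 ht.coprime_two_left
    rw [← two_mul] at h0
    exact (h2u.mul_right_eq_zero).1 (by exact_mod_cast h0)
  have hss : shiftOne m t w s = s := by
    have h := key (1 + s)
    rw [shiftOne_apply _ (1 + s + s), shiftOne_apply _ (1 + s), if_neg, if_neg,
      add_right_inj] at h
    · exact (z.injective h).symm
    · simpa using hs
    · simpa [add_assoc] using h2s
  -- Now 1 + s is not shifted but 1 is, so z(1 + s) = z(1 + tw + s).
  have h := key 1
  rw [hss, add_left_inj, shiftOne_apply, shiftOne_apply, if_neg (by simpa using hs),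
    if_pos (map_one _)] at h
  have h := z.injective h
  rw [add_right_comm] at h
  exact left_eq_add.1 h

theorem mul_shiftOne_twist (ht1 : t ≠ 1) {v : ZMod (m * t)} {z : Equiv.Perm (ZMod (m * t))}
    (hz : z 0 = 0 ∧ ∀ i, z (i + t) = z i + v) (w : ZMod (m * t)) :
    (z * shiftOne m t w) 0 = 0 ∧
      ∀ i, (z * shiftOne m t w) (i + t) = (z * shiftOne m t w) i + v := by
  simp only [Equiv.Perm.mul_apply]
  refine ⟨by rw [shiftOne_zero ht1, hz.1], fun i => ?_⟩
  rw [shiftOne_add_natCast, hz.2]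

theorem red_natCast_ne_zero (ht : 0 < t) {s : Fin t} (hs : s ≠ ⟨0, ht⟩) :
    red m t ((s : ℕ) : ZMod (m * t)) ≠ 0 := by
  rw [map_natCast, ne_eq, ZMod.natCast_eq_zero_iff]
  intro h
  exact hs (Fin.ext (Nat.eq_zero_of_dvd_of_lt h s.2))

/-- The orbit relation on permutations fixing `0`: translate the argument and renormalize. -/
def IsTranslate {n : ℕ} (z y : Equiv.Perm (ZMod n)) : Prop :=
  ∃ r, ∀ i, y i = z (i + r) - z r

theorem IsTranslate.twist {v : ZMod (m * t)} {z y : Equiv.Perm (ZMod (m * t))}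
    (h : IsTranslate z y) (hz : ∀ i, z (i + t) = z i + v) :
    y 0 = 0 ∧ ∀ i, y (i + t) = y i + v := by
  obtain ⟨r, hr⟩ := h
  refine ⟨by rw [hr, zero_add, sub_self], fun i => ?_⟩
  rw [hr, hr, add_right_comm, hz]
  ring

theorem natCast_mul_eq_zero_iff (a : ℕ) (ht : 0 < t) :
    (t : ZMod (m * t)) * a = 0 ↔ m ∣ a := by
  have h := natCast_mul_eq_iff (m := m) ht a 0
  rw [mul_zero, Nat.cast_zero, Nat.cast_zero, Nat.cast_mul] at h
  rw [h, ZMod.natCast_eq_zero_iff]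

end ZModPerm

/-! ### Counting permutations by their periods -/

namespace ZModPerm

variable {m t : ℕ} [NeZero (m * t)]

/-- A period outside the multiples of `t` may be taken among `1, …, t - 1`. -/
theorem exists_period_lt (ht : 0 < t) {v : ZMod (m * t)} {z : Equiv.Perm (ZMod (m * t))}
    (hz : z 0 = 0 ∧ ∀ i, z (i + t) = z i + v) {c : ZMod (m * t)} (hc : IsPeriod z c)
    (hc0 : red m t c ≠ 0) : ∃ s : Fin t, s ≠ ⟨0, ht⟩ ∧ IsPeriod z ((s : ℕ) : ZMod (m * t)) := by
  refine ⟨⟨c.val % t, Nat.mod_lt _ ht⟩, ?_, ?_⟩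
  · rw [ne_eq, Fin.mk.injEq, ← Nat.dvd_iff_mod_eq_zero, ← red_eq_zero_iff]
    exact hc0
  · have htp : (t : ZMod (m * t)) ∈ periods z hz.1 := by
      intro i
      have h0 := hz.2 0
      rw [zero_add, hz.1, zero_add] at h0
      rw [hz.2, h0]
    have hsub := (periods z hz.1).sub_mem (mem_periods.2 hc)
      ((periods z hz.1).nsmul_mem htp (c.val / t))
    have heq : c - (c.val / t) • (t : ZMod (m * t)) = ((c.val % t : ℕ) : ZMod (m * t)) := by
      rw [sub_eq_iff_eq_add, nsmul_eq_mul]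
      conv_lhs => rw [← ZMod.natCast_zmod_val c, ← Nat.mod_add_div c.val t]
      push_cast
      ring
    rw [heq] at hsub
    exact hsub

/-- Pigeonhole: if each of the t shifts left an unwanted period among 1, …, t - 1, two shifts would
share one. Their difference would then be a trivial shift. -/
theorem exists_shiftOne_exact (ht : Odd t) (ht1 : t ≠ 1) (htm : t ≤ m) {v : ZMod (m * t)}
    {z : Equiv.Perm (ZMod (m * t))} (hz : z 0 = 0 ∧ ∀ i, z (i + t) = z i + v) :
    ∃ w : Fin t, ∀ c, IsPeriod (z * shiftOne m t ((w : ℕ) : ZMod (m * t))) c →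
      red m t c = 0 := by
  by_contra! hcon
  have hper (w : Fin t) : ∃ s : Fin t, s ≠ ⟨0, ht.pos⟩ ∧
      IsPeriod (z * shiftOne m t ((w : ℕ) : ZMod (m * t))) ((s : ℕ) : ZMod (m * t)) := by
    obtain ⟨c, hc, hc0⟩ := hcon w
    exact exists_period_lt ht.pos (mul_shiftOne_twist ht1 hz _) hc hc0
  choose f hf0 hf using hper
  have hinj : Function.Injective f := by
    intro a b hab
    wlog hle : (a : ℕ) ≤ b generalizing a b
    · exact (this hab.symm (by omega)).symm
    obtain ⟨d, hd⟩ := Nat.exists_eq_add_of_le hle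
    have hb := hf b
    rw [hd, Nat.cast_add, shiftOne_add, ← mul_assoc, ← hab] at hb
    have h0 := mul_eq_zero_of_isPeriod ht (red_natCast_ne_zero ht.pos (hf0 a)) (hf a) hb
    rw [natCast_mul_eq_zero_iff _ ht.pos] at h0
    -- The difference d satisfies d < t ≤ m and m ∣ d.
    have := Nat.eq_zero_of_dvd_of_lt h0 (by have := b.2; omega)
    exact Fin.ext (by omega)
  obtain ⟨w, hw⟩ := (Finite.injective_iff_surjective.1 hinj) ⟨0, ht.pos⟩
  exact hf0 w hw

/-- A permutation is recovered from its corrected version and the shift used, of which there are t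
choices. -/
theorem card_twist_le_mul (ht : Odd t) (htm : t ≤ m) (v : ZMod (m * t)) :
    Nat.card (Twist m t v) ≤ t * Nat.card (ExactTwist m t v) := by
  by_cases ht1 : t = 1
  · subst ht1
    rw [one_mul]
    refine Nat.card_le_card_of_injective (fun z : Twist m 1 v =>
      (⟨z.1, z.2, fun c _ => Subsingleton.elim _ _⟩ : ExactTwist m 1 v)) ?_
    intro a b h
    exact Subtype.ext (congrArg (fun x : ExactTwist m 1 v => x.1) h)
  · have h (z : Twist m t v) := exists_shiftOne_exact ht ht1 htm z.2
    choose w hw using h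
    have hcard : t * Nat.card (ExactTwist m t v) = Nat.card (Fin t × ExactTwist m t v) := by
      rw [Nat.card_prod, Nat.card_fin]
    rw [hcard]
    refine Nat.card_le_card_of_injective (fun z : Twist m t v => (w z,
      (⟨z.1 * shiftOne m t ((w z : ℕ) : ZMod (m * t)), mul_shiftOne_twist ht1 z.2 _, hw z⟩ :
        ExactTwist m t v))) ?_
    intro a b hab
    have h1 : w a = w b := congrArg Prod.fst hab
    have h2 := congrArg (fun x => (x.2 : ExactTwist m t v).1) hab
    dsimp only at h2
    rw [h1] at h2
    exact Subtype.ext (mul_right_cancel h2)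

/-- The permutations fixing `0` that have exactly `m` periods. -/
def ExactPeriods (n m : ℕ) :=
  {z : Equiv.Perm (ZMod n) // z 0 = 0 ∧ Nat.card {c // IsPeriod z c} = m}

instance (n m : ℕ) [NeZero n] : Finite (ExactPeriods n m) := Subtype.finite

theorem addOrderOf_natCast_right (ht : 0 < t) : addOrderOf (t : ZMod (m * t)) = m := by
  rw [ZMod.addOrderOf_coe _ (NeZero.ne _), Nat.gcd_eq_right (dvd_mul_left t m),
    Nat.mul_div_cancel _ ht]

theorem mem_zmultiples_iff_red (c : ZMod (m * t)) :
    c ∈ AddSubgroup.zmultiples (t : ZMod (m * t)) ↔ red m t c = 0 := by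
  constructor
  · rintro ⟨j, rfl⟩
    simp
  · rw [red_eq_zero_iff]
    rintro ⟨j, hj⟩
    refine ⟨j, ?_⟩
    dsimp only
    rw [← ZMod.natCast_zmod_val c, hj, natCast_zsmul, nsmul_eq_mul, Nat.cast_mul]
    exact mul_comm _ _

theorem card_red_eq_zero (ht : 0 < t) : Nat.card {c : ZMod (m * t) // red m t c = 0} = m := by
  rw [← Nat.card_congr (Equiv.subtypeEquivRight mem_zmultiples_iff_red)]
  exact (Nat.card_zmultiples _).trans (addOrderOf_natCast_right ht)

/-- The periods form a subgroup, and ℤ/mt has only one subgroup of order m. -/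
theorem card_period_eq_iff (ht : 0 < t) {z : Equiv.Perm (ZMod (m * t))} (hz : z 0 = 0) :
    Nat.card {c // IsPeriod z c} = m ↔ ∀ c, IsPeriod z c ↔ red m t c = 0 := by
  constructor
  · intro h
    have hm : Nat.card (periods z hz) = m := h
    have hle : periods z hz ≤ AddSubgroup.zmultiples (t : ZMod (m * t)) := by
      intro c hc
      rw [mem_zmultiples_iff_red, red_eq_zero_iff]
      have h1 := addOrderOf_dvd_iff_nsmul_eq_zero.1
        ((periods z hz).addOrderOf_dvd_natCard hc)
      rw [hm, ← ZMod.natCast_zmod_val c, nsmul_eq_mul, ← Nat.cast_mul,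
        ZMod.natCast_eq_zero_iff] at h1
      refine Nat.dvd_of_mul_dvd_mul_left (Nat.pos_of_ne_zero ?_) h1
      exact left_ne_zero_of_mul (NeZero.ne (m * t))
    have heq := AddSubgroup.eq_of_le_of_card_ge hle (by
      rw [hm, Nat.card_zmultiples, addOrderOf_natCast_right ht])
    intro c
    rw [← mem_zmultiples_iff_red, ← heq]
    rfl
  · intro h
    rw [Nat.card_congr (Equiv.subtypeEquivRight h), card_red_eq_zero ht]

theorem isPeriod_natCast_of_twist {v : ZMod (m * t)} {z : Equiv.Perm (ZMod (m * t))}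
    (hz : z 0 = 0 ∧ ∀ i, z (i + t) = z i + v) {c : ZMod (m * t)} (hc : red m t c = 0) :
    IsPeriod z c := by
  rw [red_eq_zero_iff] at hc
  obtain ⟨j, hj⟩ := hc
  have : c = t * j := by rw [← ZMod.natCast_zmod_val c, hj, Nat.cast_mul]
  intro i
  rw [this, apply_add_natCast_mul hz.2, apply_natCast_mul hz.1 hz.2]

theorem ExactTwist.card_period {v : ZMod (m * t)} (ht : 0 < t) (z : ExactTwist m t v) :
    Nat.card {c // IsPeriod z.1 c} = m :=
  (card_period_eq_iff ht z.2.1.1).2 fun c =>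
    ⟨z.2.2 c, isPeriod_natCast_of_twist z.2.1⟩

/-- Distinct units u give disjoint families, since z(t) = tu determines u modulo m. -/
theorem totient_mul_card_twist_le [NeZero m] (ht : Odd t) (htm : t ≤ m) :
    m.totient * Nat.card (Twist m t (t : ZMod (m * t))) ≤
      t * Nat.card (ExactPeriods (m * t) m) := by
  calc m.totient * Nat.card (Twist m t (t : ZMod (m * t)))
      = ∑ _u : (ZMod m)ˣ, Nat.card (Twist m t (t : ZMod (m * t))) := by
        rw [Finset.sum_const, Finset.card_univ, ZMod.card_units_eq_totient, smul_eq_mul]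
    _ ≤ ∑ u : (ZMod m)ˣ, t * Nat.card (ExactTwist m t (scale m t u)) :=
        Finset.sum_le_sum fun u _ =>
          (card_twist_scale_unit ht.pos u).trans (card_twist_le_mul ht htm _)
    _ = t * Nat.card (Σ u : (ZMod m)ˣ, ExactTwist m t (scale m t u)) := by
        rw [← Finset.mul_sum, Nat.card_sigma]
    _ ≤ _ := by
        refine Nat.mul_le_mul_left _ (Nat.card_le_card_of_injective
          (fun z : Σ u : (ZMod m)ˣ, ExactTwist m t (scale m t u) =>
            (⟨z.2.1, z.2.2.1.1, z.2.card_period ht.pos⟩ : ExactPeriods (m * t) m)) ?_)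
        rintro ⟨u, z⟩ ⟨u', z'⟩ h
        have h1 : z.1 = z'.1 := congrArg Subtype.val h
        have hu : u = u' := by
          have hz := z.2.1.2 0
          have hz' := z'.2.1.2 0
          rw [h1, hz'] at hz
          exact (Units.ext (scale_injective ht.pos (add_left_cancel hz))).symm
        subst hu
        exact Sigma.ext rfl (heq_of_eq (Subtype.ext h1))

/-- The identity has every residue as a period, so by `mul_eq_zero_of_isPeriod` shifting one class
by t ≠ 0 destroys all periods that are not multiples of t. For t = 1 the identity itself works. -/
theorem nonempty_exactPeriods (ht : Odd t) (hm : 2 ≤ m) : Nonempty (ExactPeriods (m * t) m) := by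
  suffices h : Nonempty (ExactTwist m t (t : ZMod (m * t))) by
    obtain ⟨z⟩ := h
    exact ⟨⟨z.1, z.2.1.1, z.card_period ht.pos⟩⟩
  have h1 : (1 : Equiv.Perm (ZMod (m * t))) 0 = 0 ∧ ∀ i : ZMod (m * t),
    (1 : Equiv.Perm (ZMod (m * t))) (i + t) = (1 : Equiv.Perm (ZMod (m * t))) i + t :=
    ⟨rfl, fun _ => rfl⟩
  by_cases ht1 : t = 1
  · subst ht1
    exact ⟨⟨1, h1, fun c _ => Subsingleton.elim _ _⟩⟩
  · refine ⟨⟨1 * shiftOne m t 1, mul_shiftOne_twist ht1 h1 1, fun c hc => ?_⟩⟩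
    by_contra hc0
    have h := mul_eq_zero_of_isPeriod ht hc0 (fun _ => rfl) hc
    rw [← Nat.cast_one, natCast_mul_eq_zero_iff _ ht.pos] at h
    exact absurd (Nat.le_of_dvd one_pos h) (by omega)

/-- The permutations with exactly `m` periods whose orbit contains a permutation together with its
inverse. -/
def SelfDual (n m : ℕ) :=
  {z : Equiv.Perm (ZMod n) // (z 0 = 0 ∧ Nat.card {c // IsPeriod z c} = m) ∧
    ∃ y, IsTranslate z y ∧ IsTranslate z y⁻¹}

/-- Both y and y⁻¹ inherit the translation constant tj of z, so t = y(y⁻¹(t)) = y(tj) = tj², and j²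
= 1 modulo m. -/
theorem SelfDual.exists_unit [NeZero m] (ht : 0 < t) (z : SelfDual (m * t) m) :
    ∃ u : (ZMod m)ˣ, u ^ 2 = 1 ∧ ∀ i, z.1 (i + t) = z.1 i + scale m t u := by
  obtain ⟨z, ⟨hz0, hzm⟩, y, hy, hy'⟩ := z
  have hper : IsPeriod z t := by
    rw [(card_period_eq_iff ht hz0).1 hzm, map_natCast, ZMod.natCast_self]
  -- Translating m times by t is the identity, so m · z(t) = 0 in ℤ/mt and t divides z(t).
  have hv : ∃ j : ℕ, z t = t * j := by
    have h1 := apply_natCast_mul hz0 hper m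
    have htm : (t : ZMod (m * t)) * m = 0 := by
      rw [← Nat.cast_mul, mul_comm t m, ZMod.natCast_self]
    rw [htm, hz0, ← ZMod.natCast_zmod_val (z t),
      ← Nat.cast_mul, eq_comm, ZMod.natCast_eq_zero_iff,
      mul_comm (z t).val m] at h1
    obtain ⟨j, hj⟩ := Nat.dvd_of_mul_dvd_mul_left (Nat.pos_of_ne_zero (NeZero.ne m)) h1
    exact ⟨j, by rw [← ZMod.natCast_zmod_val (z t), hj, Nat.cast_mul]⟩
  obtain ⟨j, hj⟩ := hv
  have hz1 : ∀ i, z (i + t) = z i + t * j := fun i => by rw [hper, hj]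
  have hyt := hy.twist hz1
  have hyt' := hy'.twist hz1
  have h1 : y⁻¹ t = t * j := by
    have := hyt'.2 0
    rwa [zero_add, hyt'.1, zero_add] at this
  have h2 : (t : ZMod (m * t)) = t * j * j := by
    rw [← apply_natCast_mul hyt.1 hyt.2, ← h1]
    exact (y.apply_symm_apply _).symm
  have h3 : (j : ZMod m) * j = 1 := by
    rw [← Nat.cast_mul, ← Nat.cast_one, ← natCast_mul_eq_iff ht, mul_one, Nat.cast_mul,
      Nat.cast_mul, ← mul_assoc]
    exact h2.symm
  refine ⟨⟨j, j, h3, h3⟩, Units.ext ((sq _).trans h3), fun i => ?_⟩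
  rw [hz1, ← scale_natCast ht]

theorem card_selfDual_le [NeZero m] (ht : 0 < t) :
    Nat.card (SelfDual (m * t) m) ≤
      Nat.card {u : (ZMod m)ˣ // u ^ 2 = 1} * Nat.card (Twist m t (t : ZMod (m * t))) := by
  choose u hu1 hu using SelfDual.exists_unit (m := m) ht
  calc Nat.card (SelfDual (m * t) m)
      ≤ Nat.card (Σ u : {u : (ZMod m)ˣ // u ^ 2 = 1}, Twist m t (scale m t (u : (ZMod m)ˣ))) := by
        refine Nat.card_le_card_of_injective (fun z : SelfDual (m * t) m =>
          (⟨⟨u z, hu1 z⟩, ⟨z.1, z.2.1.1, hu z⟩⟩ :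
            Σ u : {u : (ZMod m)ˣ // u ^ 2 = 1}, Twist m t (scale m t (u : (ZMod m)ˣ)))) ?_
        intro a b h
        exact Subtype.ext (congrArg (fun x : Σ u : {u : (ZMod m)ˣ // u ^ 2 = 1},
          Twist m t (scale m t (u : (ZMod m)ˣ)) => x.2.1) h)
    _ = ∑ u : {u : (ZMod m)ˣ // u ^ 2 = 1}, Nat.card (Twist m t (scale m t (u : (ZMod m)ˣ))) :=
        Nat.card_sigma
    _ ≤ ∑ _u : {u : (ZMod m)ˣ // u ^ 2 = 1}, Nat.card (Twist m t (t : ZMod (m * t))) :=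
        Finset.sum_le_sum fun u _ => card_twist_le _
    _ = _ := by
        rw [Finset.sum_const, Finset.card_univ, smul_eq_mul,
          Nat.card_eq_fintype_card (α := {u : (ZMod m)ˣ // u ^ 2 = 1})]

theorem card_selfDual_mul_le [NeZero m] (ht : Odd t) (htm : t ≤ m) :
    Nat.card (SelfDual (m * t) m) * squareUnitsCard m ≤
      t * Nat.card (ExactPeriods (m * t) m) := by
  refine le_trans ?_ (totient_mul_card_twist_le ht htm)
  rw [← card_sq_eq_one_mul_squareUnitsCard, mul_right_comm]
  exact Nat.mul_le_mul_right _ (card_selfDual_le ht.pos)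

end ZModPerm

/-! ### The factorization of S_n in terms of ℤ/n -/

namespace CycleFix

open ZModPerm MatchedPair

/-- Permutations of `Fin (N + 1)` as permutations of `ZMod (N + 1)`. -/
def permZMod (N : ℕ) : Equiv.Perm (Fin (N + 1)) ≃* Equiv.Perm (ZMod (N + 1)) := MulEquiv.refl _

/-- The matched pair of the factorization `S_n = C_n S_{n-1}`. -/
noncomputable abbrev pair (n : ℕ) : MatchedPair (cycleSubgroup n) (fixSubgroup n) :=
  MatchedPair.ofFactorization (isComplement_cycle_fix n)

instance isCyclic_cycleSubgroup (n : ℕ) : IsCyclic (cycleSubgroup n) :=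
  inferInstanceAs (IsCyclic (Subgroup.zpowers (finRotate n)))

variable {N : ℕ}

/-- The amount by which an element of the cycle subgroup translates. -/
def shift (b : cycleSubgroup (N + 1)) : ZMod (N + 1) := permZMod N b.1 0

theorem cycle_apply (b : cycleSubgroup (N + 1)) (i : ZMod (N + 1)) :
    permZMod N b.1 i = i + shift b := by
  obtain ⟨b, hb⟩ := b
  obtain ⟨r, rfl⟩ := mem_powers_iff_mem_zpowers.2 hb
  have h1 := finRotate_pow_apply N r i
  have h0 := finRotate_pow_apply N r 0
  rw [zero_add] at h0
  rw [← h0] at h1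
  exact h1

theorem shift_bijective : Function.Bijective (shift (N := N)) := by
  constructor
  · intro a b h
    apply Subtype.ext
    apply (permZMod N).injective
    ext1 i
    rw [cycle_apply, cycle_apply, h]
  · intro r
    refine ⟨⟨finRotate (N + 1) ^ ZMod.val r, Subgroup.pow_mem _ (Subgroup.mem_zpowers _) _⟩, ?_⟩
    have h0 := finRotate_pow_apply N (ZMod.val r) 0
    rw [zero_add] at h0
    refine h0.trans (Fin.ext ?_)
    exact Nat.mod_eq_of_lt (ZMod.val_lt r)

theorem fix_apply_zero (z : fixSubgroup (N + 1)) : permZMod N z.1 0 = 0 := z.2 0 rfl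

/-- In zb = (z ▷ b)(z ◁ b) the left factor is a translation; evaluating at 0, which z ◁ b fixes,
shows that it translates by z(shift b). -/
theorem ract_apply (z : fixSubgroup (N + 1)) (b : cycleSubgroup (N + 1)) (i : ZMod (N + 1)) :
    permZMod N ((pair (N + 1)).ract z b).1 i =
      permZMod N z.1 (i + shift b) - permZMod N z.1 (shift b) := by
  have h := equiv_spec (isComplement_cycle_fix (N + 1)) ((z : Equiv.Perm (Fin (N + 1))) * b)
  have key (i : ZMod (N + 1)) : permZMod N ((pair (N + 1)).ract z b).1 i +
      shift ((pair (N + 1)).lact z b) = permZMod N z.1 (i + shift b) := by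
    rw [← cycle_apply, ← cycle_apply, ← Equiv.Perm.mul_apply, ← Equiv.Perm.mul_apply, ← map_mul,
      ← map_mul]
    exact congrArg (fun σ => permZMod N σ i) h
  have h0 := key 0
  rw [fix_apply_zero, zero_add, zero_add] at h0
  rw [eq_sub_iff_add_eq, ← h0, key]

theorem mem_stab_iff_isPeriod (z : fixSubgroup (N + 1)) (b : cycleSubgroup (N + 1)) :
    b ∈ (pair (N + 1)).stab z ↔ IsPeriod (permZMod N z.1) (shift b) := by
  rw [mem_stab]
  constructor
  · intro h i
    rw [← sub_eq_iff_eq_add, ← ract_apply, h]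
  · intro h
    apply Subtype.ext
    apply (permZMod N).injective
    ext1 i
    rw [ract_apply, h i, add_sub_cancel_right]

theorem card_stab (z : fixSubgroup (N + 1)) :
    Nat.card ((pair (N + 1)).stab z) = Nat.card {c // IsPeriod (permZMod N z.1) c} :=
  Nat.card_congr ((Equiv.ofBijective _ shift_bijective).subtypeEquiv
    fun b => mem_stab_iff_isPeriod z b)

/-- Orbit-stabilizer, with the stabilizer read as the group of periods. -/
theorem card_orb_eq_iff {m t : ℕ} (h : N + 1 = m * t) (z : fixSubgroup (N + 1)) :
    Nat.card ((pair (N + 1)).orb z) = t ↔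
      Nat.card {c // IsPeriod (permZMod N z.1) c} = m := by
  have hc := (pair (N + 1)).card_orb_mul_card_stab z
  rw [Nat.card_congr (Equiv.ofBijective _ (shift_bijective (N := N))), Nat.card_zmod,
    card_stab] at hc
  replace hc := hc.trans h
  have hmt : 0 < m * t := by omega
  constructor
  · intro ho
    rw [ho, mul_comm] at hc
    exact Nat.eq_of_mul_eq_mul_right (Nat.pos_of_mul_pos_left hmt) hc
  · intro hp
    rw [hp, mul_comm] at hc
    exact Nat.eq_of_mul_eq_mul_left (Nat.pos_of_mul_pos_right hmt) hc

theorem isTranslate_of_mem_orb {z y : fixSubgroup (N + 1)} (h : y ∈ (pair (N + 1)).orb z) :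
    IsTranslate (permZMod N z.1) (permZMod N y.1) := by
  obtain ⟨b, rfl⟩ := h
  exact ⟨shift b, fun i => ract_apply z b i⟩

theorem exists_injective_exactPeriods {m t : ℕ} (h : N + 1 = m * t) :
    ∃ f : ExactPeriods (N + 1) m →
      {z : fixSubgroup (N + 1) // Nat.card ((pair (N + 1)).orb z) = t}, Function.Injective f := by
  refine ⟨fun z => ⟨⟨(permZMod N).symm z.1, ?_⟩, (card_orb_eq_iff h _).2 z.2.2⟩, ?_⟩
  · intro i hi
    obtain rfl : i = 0 := Fin.ext hi
    exact z.2.1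
  · intro a b hab
    exact Subtype.ext ((permZMod N).symm.injective (congrArg (fun x => x.1.1) hab))

theorem card_selfDual_orb_le {m t : ℕ} (h : N + 1 = m * t) :
    Nat.card {z : fixSubgroup (N + 1) // Nat.card ((pair (N + 1)).orb z) = t ∧
      ∃ y ∈ (pair (N + 1)).orb z, y⁻¹ ∈ (pair (N + 1)).orb z} ≤
      Nat.card (SelfDual (N + 1) m) := by
  have : Finite (SelfDual (N + 1) m) := Subtype.finite
  refine Nat.card_le_card_of_injective (fun z => (⟨permZMod N z.1.1,
    ⟨fix_apply_zero _, (card_orb_eq_iff h _).1 z.2.1⟩, ?_⟩ : SelfDual (N + 1) m)) ?_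
  · obtain ⟨y, hy, hy'⟩ := z.2.2
    exact ⟨_, isTranslate_of_mem_orb hy, isTranslate_of_mem_orb hy'⟩
  · intro a b hab
    exact Subtype.ext (Subtype.ext ((permZMod N).injective
      (congrArg (fun x : SelfDual (N + 1) m => x.1) hab)))

/-- The equation n = mt is a hypothesis so that n can be replaced by a successor, for which `Fin`
and `ZMod` agree definitionally. -/
theorem nonempty_card_orb_eq {n m t : ℕ} (h : n = m * t) (ht : Odd t) (hm : 2 ≤ m) :
    Nonempty {z : fixSubgroup n // Nat.card ((pair n).orb z) = t} := by
  have hn : 0 < n := h ▸ Nat.mul_pos (by omega) ht.pos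
  obtain ⟨N, rfl⟩ : ∃ N, n = N + 1 := Nat.exists_eq_succ_of_ne_zero hn.ne'
  obtain ⟨f, -⟩ := exists_injective_exactPeriods h
  have : NeZero (m * t) := ⟨h ▸ hn.ne'⟩
  have hne : Nonempty (ExactPeriods (N + 1) m) := h ▸ nonempty_exactPeriods ht hm
  exact hne.map f

theorem card_selfDual_orb_mul_le {n m t : ℕ} (h : n = m * t) (ht : Odd t) (htm : t ≤ m) :
    Nat.card {z : fixSubgroup n // Nat.card ((pair n).orb z) = t ∧
      ∃ y ∈ (pair n).orb z, y⁻¹ ∈ (pair n).orb z} * squareUnitsCard m ≤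
      t * Nat.card {z : fixSubgroup n // Nat.card ((pair n).orb z) = t} := by
  have hn : 0 < n := h ▸ Nat.mul_pos (ht.pos.trans_le htm) ht.pos
  obtain ⟨N, rfl⟩ : ∃ N, n = N + 1 := Nat.exists_eq_succ_of_ne_zero hn.ne'
  obtain ⟨f, hf⟩ := exists_injective_exactPeriods h
  have : NeZero (m * t) := ⟨h ▸ hn.ne'⟩
  have : NeZero m := ⟨(ht.pos.trans_le htm).ne'⟩
  have hle : Nat.card (SelfDual (N + 1) m) * squareUnitsCard m ≤
      t * Nat.card (ExactPeriods (N + 1) m) := h ▸ card_selfDual_mul_le ht htm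
  exact (Nat.mul_le_mul_right _ (card_selfDual_orb_le h)).trans
    (hle.trans (Nat.mul_le_mul_left _ (Nat.card_le_card_of_injective f hf)))

end CycleFix

/-! ### The limit -/

theorem mainTheorem7 (k : Type*) [Field k] [IsAlgClosed k] [CharZero k] (t : ℕ) (ht : Odd t) :
    (∀ m : ℕ, 2 ≤ m → Finite (Irrep k (J k (m * t)) t) ∧ Nonempty (Irrep k (J k (m * t)) t)) ∧
    Filter.Tendsto
      (fun m : ℕ =>
        (Nat.card {V : Irrep k (J k (m * t)) t // Bismash.indicator V = 1} : ℝ) /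
          (Nat.card (Irrep k (J k (m * t)) t) : ℝ))
      Filter.atTop (nhds 0) := by
  have hne (m : ℕ) (hm : 2 ≤ m) : Nonempty (Irrep k (J k (m * t)) t) := by
    obtain ⟨z⟩ := CycleFix.nonempty_card_orb_eq rfl ht hm
    exact ⟨Bismash.orbitIrrep _ ht.pos (z, 1)⟩
  refine ⟨fun m hm => ⟨Bismash.finite_irrep _ ht.pos, hne m hm⟩, ?_⟩
  have hlim : Filter.Tendsto (fun m : ℕ => (t : ℝ) / (squareUnitsCard m : ℝ)) Filter.atTop
      (nhds 0) :=
    (tendsto_natCast_atTop_atTop.comp tendsto_squareUnitsCard).const_div_atTop _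
  refine squeeze_zero' (Filter.Eventually.of_forall fun m => by positivity) ?_ hlim
  filter_upwards [Filter.eventually_ge_atTop 2, Filter.eventually_ge_atTop t] with m hm htm
  have : NeZero m := ⟨by omega⟩
  have : Finite (Irrep k (J k (m * t)) t) := Bismash.finite_irrep _ ht.pos
  have := hne m hm
  have := CycleFix.nonempty_card_orb_eq (n := m * t) rfl ht hm
  have h1 := Bismash.card_indicator_eq_one_mul_le (k := k) (CycleFix.pair (m * t)) ht.pos
  have h2 := CycleFix.card_selfDual_orb_mul_le (n := m * t) rfl ht htm
  set A := Nat.card {V : Irrep k (J k (m * t)) t // Bismash.indicator V = 1}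
  set I := Nat.card (Irrep k (J k (m * t)) t)
  set Z := Nat.card {z : fixSubgroup (m * t) // Nat.card ((CycleFix.pair (m * t)).orb z) = t}
    with hZ
  have hI : 0 < I := Nat.card_pos
  have hZ0 : 0 < Z := Nat.card_pos
  have hS := squareUnitsCard_pos m
  rw [div_le_div_iff₀ (by exact_mod_cast hI) (by exact_mod_cast hS)]
  -- With B the number of points whose orbit contains some y and y⁻¹, this combines A·Z ≤ B·I with
  -- B·`squareUnitsCard m` ≤ t·Z, and cancels Z.
  have key : A * squareUnitsCard m ≤ t * I := by
    refine Nat.le_of_mul_le_mul_left ?_ hZ0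
    calc Z * (A * squareUnitsCard m) = A * Z * squareUnitsCard m := by ring
      _ ≤ _ := Nat.mul_le_mul_right _ h1
      _ = _ := mul_right_comm _ _ _
      _ ≤ _ := Nat.mul_le_mul_right _ h2
      _ = Z * (t * I) := by ring
  exact_mod_cast key
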